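/- Let $\Phi$ be an irreducible reduced crystallographic root system spanning a Euclidean space $V$ of dimension $n$, with simple roots $\alpha_1,\dots,\alpha_n$ and highest root $\tilde\alpha=\sum_i c_i\alpha_i$, the inner product being normalized so that $\langle\tilde\alpha,\tilde\alpha\rangle=2$. For $\alpha\in\Phi$ let $\alpha^\vee=2\alpha/\langle\alpha,\alpha\rangle$, let $\mathrm{ht}(\alpha)$ be the sum of the coefficients of $\alpha$ in the simple roots, and let $h=1+\mathrm{ht}(\tilde\alpha)$ be the Coxeter number. Let $\mathcal Q^\vee$ be the lattice generated by the coroots $\alpha^\vee$, let $\omega_1^\vee,\dots,\omega_n^\vee$ be the basis of $V$ dual to $\alpha_1,\dots,\alpha_n$, and let $\rho^\vee=\sum_i\omega_i^\vee$. Let $r$ be the ratio of the squared length of a long root to that of a short root ($r=1$ if all roots have the same length). Let $g^\vee$ be the dual Coxeter number of the dual root system $\Phi^\vee=\{\alpha^\vee:\alpha\in\Phi\}$, that is, $g^\vee=1+\mathrm{ht}(\gamma)$, where $\gamma\in\Phi$ is the root whose coroot $\gamma^\vee$ is the highest root of $\Phi^\vee$ (with simple roots $\alpha_1^\vee,\dots,\alpha_n^\vee$).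 For $q\in\mathcal Q^\vee$ let $$\mathrm{size}^\vee(q)=\sum_{i=0}^n\Big\langle \frac{c_i}{2}q-\omega_i^\vee,\,q\Big\rangle=\Big\langle\frac h2 q-\rho^\vee,\,q\Big\rangle,\qquad c_0=1,\ \omega_0^\vee=0 .$$ Let $\widetilde W$ be the affine Weyl group, generated by the reflections $x\mapsto x-\langle\alpha_i,x\rangle\alpha_i^\vee$ for $1\le i\le n$ and by $x\mapsto x-(\langle\tilde\alpha,x\rangle-1)\tilde\alpha$. Let $b$ be a positive integer coprime to $h$, write $b=t_bh+r_b$ with integers $t_b\ge 0$ and $0<r_b<h$, and let $$\mathcal S(b)=\{x\in V:\ \langle x,\alpha\rangle\ge -t_b\text{ for all }\alpha\in\Phi\text{ with }\mathrm{ht}(\alpha)=r_b,\ \ \langle x,\alpha\rangle\le t_b+1\text{ for all }\alpha\in\Phi\text{ with }\mathrm{ht}(\alpha)=h-r_b\}.$$ Then $$\max_{q\in\mathcal S(b)\cap\mathcal Q^\vee}\mathrm{size}^\vee(q)=\frac{r\,g^\vee}{h}\cdot\frac{n(b^2-1)(h+1)}{24}.$$ Moreover, there is a unique $w_b\in\widetilde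 W$ with $w_b\big(\tfrac1h\rho^\vee\big)=\tfrac bh\rho^\vee$, the point $q_*=w_b^{-1}(0)$ lies in $\mathcal S(b)\cap\mathcal Q^\vee$, and $q_*$ is the only point of $\mathcal S(b)\cap\mathcal Q^\vee$ at which the maximum is attained. -/

import Mathlib

open scoped RealInnerProductSpace

namespace SimultaneousCores

noncomputable section

section General

variable {ι R M N : Type*} [CommRing R] [AddCommGroup M] [Module R M]
  [AddCommGroup N] [Module R N] {P : RootPairing ι R M N}

/-- The highest root (as an index): a root of maximal height. For an irreducible root system there
is exactly one. -/
def highestRoot [CharZero R] [Finite ι] [Nonempty ι] (B : P.Base) : ι :=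
  (Finite.exists_max B.height).choose

theorem height_le_height_highestRoot [CharZero R] [Finite ι] [Nonempty ι] (B : P.Base) (i : ι) :
    B.height i ≤ B.height (highestRoot B) :=
  (Finite.exists_max B.height).choose_spec i

/-- The Coxeter number: one plus the height of the highest root. -/
def coxeterNumber [CharZero R] [Finite ι] [Nonempty ι] (B : P.Base) : ℕ :=
  (B.height (highestRoot B)).toNat + 1

/-- The dual Coxeter number of a root system: one plus the height, with respect to the simple
coroots, of the coroot of the highest root. (It is `n + 1` for `Cₙ` and `2n - 1` for `Bₙ`.) -/
def dualCoxeterNumber [CharZero R] [Finite ι] [Nonempty ι] (B : P.Base) : ℤ :=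
  B.flip.height (highestRoot B) + 1

/-- The fundamental coweight `ωᵢ` attached to the simple root `αᵢ`: the families `ω` and `α` are
dual bases. -/
def fundamentalCoweight [P.IsRootSystem] (B : P.Base) (i : B.support) : N :=
  P.toLinearMap.flip.toPerfPair.symm (B.toWeightBasis.coord i)

theorem toLinearMap_root_fundamentalCoweight [P.IsRootSystem] [DecidableEq ι]
    (B : P.Base) (i j : B.support) :
    P.toLinearMap (P.root j) (fundamentalCoweight B i) = if j = i then 1 else 0 := by
  rw [fundamentalCoweight, LinearMap.apply_toPerfPair_flip, Module.Basis.coord_apply,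
    B.toWeightBasis_repr_root, Finsupp.single_apply]

/-- The sum `ρ` of the fundamental coweights. -/
def rhoCheck [P.IsRootSystem] (B : P.Base) : N :=
  ∑ i : B.support, fundamentalCoweight B i

end General

section Euclidean

variable {ι V : Type*} [NormedAddCommGroup V] [InnerProductSpace ℝ V]

/-- A root pairing of a Euclidean space `V` with itself is a Euclidean root system if the pairing is
the inner product of `V`, and the coroot of a root `α` is `2α / ⟪α, α⟫`. The axioms of a root pairing
then say that the set of roots is stable under the orthogonal reflections in the roots. -/
structure IsEuclidean (P : RootPairing ι ℝ V V) : Prop where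
  toLinearMap_eq : ∀ x y : V, P.toLinearMap x y = ⟪x, y⟫
  coroot_eq : ∀ i, P.coroot i = (2 / ⟪P.root i, P.root i⟫) • P.root i

variable {P : RootPairing ι ℝ V V}

/-- The ratio of the squared lengths of a long and a short root: `⟪α, α⟫ / ⟪β, β⟫` for `α` a root of maximal length and `β` a root of minimal length. It
is `1` in the simply-laced types, `2` in types `B`, `C`, `F₄` and `3` in type `G₂`. -/
def lengthRatio (P : RootPairing ι ℝ V V) : ℝ :=
  (⨆ i, ⟪P.root i, P.root i⟫) / (⨅ i, ⟪P.root i, P.root i⟫)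

/-- The coroot lattice. -/
def corootLattice (P : RootPairing ι ℝ V V) : Set V :=
  (P.corootSpan ℤ : Set V)

/-- The reflection in the hyperplane `⟪αᵢ, x⟫ = k`. -/
def affineReflection (P : RootPairing ι ℝ V V) (i : ι) (k : ℝ) : V ≃ᵃ[ℝ] V :=
  (P.coreflection i).toAffineEquiv.trans (AffineEquiv.constVAdd ℝ V (k • P.coroot i))

theorem affineReflection_apply (hP : IsEuclidean P) (i : ι) (k : ℝ) (x : V) :
    affineReflection P i k x = x - (⟪P.root i, x⟫ - k) • P.coroot i := by
  simp only [affineReflection, AffineEquiv.trans_apply, LinearEquiv.coe_toAffineEquiv,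
    RootPairing.coreflection_apply, AffineEquiv.constVAdd_apply, vadd_eq_add, hP.toLinearMap_eq]
  module

/-- The affine Weyl group: the group generated by the simple reflections and the affine simple
reflection `x ↦ x - (⟪θ, x⟫ - 1) θ`, where `θ` is the highest root, normalized to `⟪θ, θ⟫ = 2`. -/
def affineWeylGroup [Finite ι] [Nonempty ι] (B : P.Base) : Subgroup (V ≃ᵃ[ℝ] V) :=
  Subgroup.closure
    ({g | ∃ i ∈ B.support, g = affineReflection P i 0} ∪ {affineReflection P (highestRoot B) 1})

/-- The Sommers region of `b`. For `b` coprime to the Coxeter number `h`, with `b = t h + r` and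
`0 < r < h`, it is cut out by `⟪x, α⟫ ≥ -t` for all roots `α` of height `r`, and `⟪x, α⟫ ≤ t + 1` for
all roots `α` of height `h - r`. -/
def sommersRegion [Finite ι] [Nonempty ι] (B : P.Base) (b : ℕ) : Set V :=
  {x | (∀ i, B.height i = (b % coxeterNumber B : ℕ) →
          -((b / coxeterNumber B : ℕ) : ℝ) ≤ ⟪x, P.root i⟫) ∧
       (∀ i, B.height i = (coxeterNumber B : ℤ) - (b % coxeterNumber B : ℕ) →
          ⟪x, P.root i⟫ ≤ ((b / coxeterNumber B : ℕ) : ℝ) + 1)}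

/-- The coefficient `cᵢ` of the simple root `αᵢ` in the highest root. -/
def highestRootCoeff [Finite ι] [Nonempty ι] [P.IsRootSystem] (B : P.Base) (i : B.support) : ℝ :=
  B.toWeightBasis.repr (P.root (highestRoot B)) i

/-- The statistic `sizeᵢ(q) = ⟪(cᵢ / 2) q - ωᵢ, q⟫`, for `i` the index of a simple root or `i = 0`
(here `none`), where `c₀ = 1` and `ω₀ = 0`. -/
def sizeAt [Finite ι] [Nonempty ι] [P.IsRootSystem] (B : P.Base) : Option B.support → V → ℝ
  | none, q => ⟪(1 / 2 : ℝ) • q - 0, q⟫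
  | some i, q => ⟪(highestRootCoeff B i / 2) • q - fundamentalCoweight B i, q⟫

/-- The size statistic: the sum of the statistics `sizeᵢ` over `i = 0` and all simple roots. -/
def size [Finite ι] [Nonempty ι] [P.IsRootSystem] (B : P.Base) (q : V) : ℝ :=
  ∑ i : Option B.support, sizeAt B i q

theorem sum_highestRootCoeff [Finite ι] [Nonempty ι] [P.IsRootSystem] (B : P.Base) :
    ∑ i : B.support, highestRootCoeff B i = B.height (highestRoot B) := by
  classical
  obtain ⟨f, -, -, hf⟩ := B.exists_root_eq_sum_int (highestRoot B)
  rw [RootPairing.Base.height_eq_sum hf]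
  have h : P.root (highestRoot B) = ∑ j : B.support, (f j : ℝ) • B.toWeightBasis j := by
    rw [hf, ← Finset.sum_coe_sort]
    simp [← Int.cast_smul_eq_zsmul ℝ]
  simp only [highestRootCoeff, h, Module.Basis.repr_sum_self]
  push_cast
  exact Finset.sum_coe_sort B.support (fun j ↦ (f j : ℝ))

/-- The closed form of the size statistic. -/
theorem size_eq [Finite ι] [Nonempty ι] [P.IsRootSystem] (B : P.Base) (q : V) :
    size B q = ⟪((coxeterNumber B : ℝ) / 2) • q - rhoCheck B, q⟫ := by
  have hpos : 0 ≤ B.height (highestRoot B) := by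
    obtain ⟨i, hi⟩ := B.support_nonempty
    have := height_le_height_highestRoot B i
    rw [B.height_one_of_mem_support hi] at this
    lia
  have hh : (coxeterNumber B : ℝ) = B.height (highestRoot B) + 1 := by
    have : (coxeterNumber B : ℤ) = B.height (highestRoot B) + 1 := by
      simp [coxeterNumber, Int.toNat_of_nonneg hpos]
    exact_mod_cast this
  rw [size, Fintype.sum_option, hh, ← sum_highestRootCoeff]
  simp only [sizeAt, rhoCheck, inner_sub_left, real_inner_smul_left, sum_inner,
    Finset.sum_sub_distrib, inner_zero_left]
  rw [← Finset.sum_mul, ← Finset.sum_div]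
  ring

end Euclidean

end

end SimultaneousCores

/-! Completing the square gives `size q` = (h/2)|q − ρ/h|² − |ρ|²/(2h). An element w of the affine
Weyl group with w(ρ/h) = bρ/h is an isometry. Hence, with y = w q, the size equals |ρ|²(b² − 1)/(2h)
minus half of 2b⟪ρ, y⟫ − h|y|² (`size_eq_add`). Moreover w carries the Sommers region into the
dilated alcove of dominant y with ⟪y, θ⟫ ≤ b (`map_sommersRegion`).

Two identities, ∑ sign(α) α^∨ = 4ρ and ∑ ⟪x, α⟫ α^∨ = 2h x, both over all roots, turn 2(2b⟪ρ, y⟫ −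
h|y|²) into a sum of terms (2/⟪α, α⟫) |⟪y, α⟫| (b − |⟪y, α⟫|) (`two_mul_sub_eq_sum`). On the dilated
alcove every term is nonnegative, which gives the bound, and y = 0 attains it. In the equality case
y/b pairs with every root to 0 or ±1. Coprimality puts y/b in the coroot lattice, where the only
such vector is 0 (`eq_zero_of_abs_inner_le_one`), so y = 0.

The constant comes from |ρ|² = r g n (h + 1)/12, a form of the strange formula
(`inner_sum_rootSign_smul_root`, `inner_rhoCheck_self`). It is proved without Lie algebras, by
averaging products of signs of roots over rotations inside rank-two subsystems.

The element w exists because the orbit of bρ/h meets the fundamental alcove only at ρ/h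
(`exists_map_eq_smul_rhoCheck`). It is unique because ρ/h has trivial stabilizer
(`eq_one_of_fixes`). -/

namespace SimultaneousCores

/-! ### Inner products, heights and signs of roots -/

section Basics

variable {ι V : Type*} [NormedAddCommGroup V] [InnerProductSpace ℝ V]
  {P : RootPairing ι ℝ V V}

theorem IsEuclidean.flip (hP : IsEuclidean P) : IsEuclidean P.flip where
  toLinearMap_eq x y := by
    rw [RootPairing.flip_toLinearMap, LinearMap.flip_apply, hP.toLinearMap_eq, real_inner_comm]
  coroot_eq i := by
    have h0 : ⟪P.root i, P.root i⟫ ≠ 0 := inner_self_ne_zero.mpr (P.ne_zero i)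
    simp only [RootPairing.flip_coroot, RootPairing.flip_root, hP.coroot_eq i,
      real_inner_smul_left, real_inner_smul_right, smul_smul]
    rw [show 2 / (2 / ⟪P.root i, P.root i⟫ * (2 / ⟪P.root i, P.root i⟫ *
      ⟪P.root i, P.root i⟫)) * (2 / ⟪P.root i, P.root i⟫) = 1 by field_simp, one_smul]

theorem IsEuclidean.inner_root_coroot (hP : IsEuclidean P) (i j : ι) :
    ⟪P.root i, P.coroot j⟫ = P.pairing i j := by
  rw [← hP.toLinearMap_eq, RootPairing.root_coroot_eq_pairing]

theorem inner_root_self_pos (P : RootPairing ι ℝ V V) (i : ι) : 0 < ⟪P.root i, P.root i⟫ :=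
  real_inner_self_pos.mpr (P.ne_zero i)

theorem IsEuclidean.inner_coroot (hP : IsEuclidean P) (x : V) (i : ι) :
    ⟪x, P.coroot i⟫ = 2 / ⟪P.root i, P.root i⟫ * ⟪x, P.root i⟫ := by
  rw [hP.coroot_eq, real_inner_smul_right]

theorem IsEuclidean.two_mul_inner_root (hP : IsEuclidean P) (i j : ι) :
    2 * ⟪P.root i, P.root j⟫ = P.pairing i j * ⟪P.root j, P.root j⟫ := by
  rw [← hP.inner_root_coroot, hP.inner_coroot]
  have := (inner_root_self_pos P j).ne'
  field_simp

theorem IsEuclidean.inner_coroot_self (hP : IsEuclidean P) (i : ι) :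
    ⟪P.coroot i, P.coroot i⟫ = 4 / ⟪P.root i, P.root i⟫ := by
  rw [hP.coroot_eq, real_inner_smul_right, real_inner_smul_left]
  have := (inner_root_self_pos P i).ne'
  field_simp
  norm_num

theorem IsEuclidean.reflection_apply (hP : IsEuclidean P) (i : ι) (x : V) :
    P.reflection i x = x - ⟪x, P.root i⟫ • P.coroot i := by
  have h : P.coroot' i x = ⟪x, P.coroot i⟫ := hP.toLinearMap_eq x _
  rw [RootPairing.reflection_apply, h, hP.coroot_eq, real_inner_smul_right, smul_smul, mul_comm]

theorem IsEuclidean.inner_reflection_reflection (hP : IsEuclidean P) (i : ι) (x y : V) :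
    ⟪P.reflection i x, P.reflection i y⟫ = ⟪x, y⟫ := by
  have h0 := (inner_root_self_pos P i).ne'
  simp only [hP.reflection_apply, hP.coroot_eq, inner_sub_left, inner_sub_right,
    real_inner_smul_left, real_inner_smul_right, real_inner_comm y (P.root i)]
  field_simp
  ring

theorem IsEuclidean.inner_reflection_left (hP : IsEuclidean P) (i : ι) (x y : V) :
    ⟪P.reflection i x, y⟫ = ⟪x, P.reflection i y⟫ := by
  rw [← hP.inner_reflection_reflection i x, RootPairing.reflection_same]

theorem root_neg (P : RootPairing ι ℝ V V) (i : ι) :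
    P.root (P.reflectionPerm i i) = -P.root i := by
  simp

theorem coroot_neg (P : RootPairing ι ℝ V V) (i : ι) :
    P.coroot (P.reflectionPerm i i) = -P.coroot i := by
  simp

theorem height_neg (B : P.Base) (i : ι) : B.height (P.reflectionPerm i i) = -B.height i :=
  B.height_reflectionPerm_self i

theorem root_reflectionPerm_eq_sub [P.IsCrystallographic] (i j : ι) :
    P.root (P.reflectionPerm j i) = P.root i - P.pairingIn ℤ i j • P.root j := by
  rw [RootPairing.root_reflectionPerm, RootPairing.reflection_apply_root' ℤ]

theorem height_reflectionPerm [P.IsCrystallographic] (B : P.Base) (i j : ι) :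
    B.height (P.reflectionPerm j i) = B.height i - P.pairingIn ℤ i j * B.height j := by
  have h : P.root (P.reflectionPerm j i) = P.root i + (-P.pairingIn ℤ i j) • P.root j := by
    rw [root_reflectionPerm_eq_sub, neg_smul, sub_eq_add_neg]
  rw [B.height_add_zsmul h, smul_eq_mul]
  ring

theorem IsEuclidean.inner_simpleRoot_rhoCheck (hP : IsEuclidean P) [P.IsRootSystem] (B : P.Base)
    {j : ι} (hj : j ∈ B.support) : ⟪P.root j, rhoCheck B⟫ = 1 := by
  classical
  rw [rhoCheck, inner_sum]
  simp only [← hP.toLinearMap_eq]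
  have := fun i ↦ toLinearMap_root_fundamentalCoweight B i ⟨j, hj⟩
  simp only at this
  simp [this]

theorem IsEuclidean.inner_root_rhoCheck (hP : IsEuclidean P) [P.IsRootSystem] (B : P.Base)
    (i : ι) : ⟪P.root i, rhoCheck B⟫ = B.height i := by
  obtain ⟨f, -, -, hf⟩ := B.exists_root_eq_sum_int i
  rw [RootPairing.Base.height_eq_sum hf, hf, sum_inner]
  push_cast
  refine Finset.sum_congr rfl fun j hj ↦ ?_
  rw [← Int.cast_smul_eq_zsmul ℝ, real_inner_smul_left, hP.inner_simpleRoot_rhoCheck B hj, mul_one]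

/-- Vectors are determined by their inner products with the simple roots. -/
theorem eq_of_inner_simpleRoot_eq [P.IsRootSystem] (B : P.Base) {x y : V}
    (h : ∀ j ∈ B.support, ⟪P.root j, x⟫ = ⟪P.root j, y⟫) : x = y :=
  InnerProductSpace.ext_inner_left_basis B.toWeightBasis fun j ↦ by simpa using h j j.2

/-- The sign of a root: `1` if it is positive and `-1` if it is negative. -/
noncomputable def rootSign (B : P.Base) (i : ι) : ℝ :=
  ((B.height i).sign : ℝ)

theorem rootSign_of_isPos {B : P.Base} {i : ι} (hi : B.IsPos i) : rootSign B i = 1 := by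
  simp [rootSign, Int.sign_eq_one_of_pos hi]

theorem rootSign_neg (B : P.Base) (i : ι) :
    rootSign B (P.reflectionPerm i i) = -rootSign B i := by
  simp [rootSign, height_neg]

theorem isPos_or_isPos_neg (B : P.Base) (i : ι) :
    B.IsPos i ∨ B.IsPos (P.reflectionPerm i i) :=
  RootPairing.Base.IsPos.or_neg B i

theorem reflectionPerm_neg (P : RootPairing ι ℝ V V) (i j : ι) :
    P.reflectionPerm j (P.reflectionPerm i i) =
      P.reflectionPerm (P.reflectionPerm j i) (P.reflectionPerm j i) := by
  apply P.root.injective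
  rw [root_neg, P.root_reflectionPerm, root_neg, P.root_reflectionPerm, map_neg]

theorem rootSign_reflectionPerm [Finite ι] [P.IsCrystallographic] [P.IsReduced] (B : P.Base)
    {i j : ι} (hj : j ∈ B.support) (hij : i ≠ j) (hij' : i ≠ P.reflectionPerm j j) :
    rootSign B (P.reflectionPerm j i) = rootSign B i := by
  rcases isPos_or_isPos_neg B i with hi | hi
  · rw [rootSign_of_isPos hi, rootSign_of_isPos (hi.reflectionPerm hj hij)]
  · have hne : P.reflectionPerm i i ≠ j := by
      rintro rfl
      exact hij' (P.root.injective (by rw [root_neg, root_neg, neg_neg]))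
    have h := hi.reflectionPerm hj hne
    rw [reflectionPerm_neg] at h
    have h1 := rootSign_of_isPos h
    have h2 := rootSign_of_isPos hi
    rw [rootSign_neg] at h1 h2
    linarith

/-- The classical fact that ρ is half the sum of the positive coroots; the 4 appears because each
positive coroot is counted twice, once through its negative. A simple reflection preserves all signs
except those of ±αⱼ, so only these two roots contribute to the pairing with αⱼ. -/
theorem IsEuclidean.sum_rootSign_smul_coroot (hP : IsEuclidean P) [Fintype ι]
    [P.IsRootSystem] [P.IsCrystallographic] [P.IsReduced] (B : P.Base) :
    ∑ i, rootSign B i • P.coroot i = (4 : ℝ) • rhoCheck B := by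
  classical
  refine eq_of_inner_simpleRoot_eq B fun j hj ↦ ?_
  rw [real_inner_smul_right, hP.inner_simpleRoot_rhoCheck B hj, inner_sum]
  simp only [real_inner_smul_right, hP.inner_root_coroot]
  have h1 : ∑ i, rootSign B i * P.pairing j i =
      -∑ i, rootSign B (P.reflectionPerm j i) * P.pairing j i := by
    rw [← Equiv.sum_comp (P.reflectionPerm j), ← Finset.sum_neg_distrib]
    refine Finset.sum_congr rfl fun i _ ↦ ?_
    rw [P.pairing_reflectionPerm, P.pairing_reflectionPerm_self_left]
    ring
  have hne : j ≠ P.reflectionPerm j j := fun h ↦ by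
    have h' := height_neg B j
    rw [← h] at h'
    exact B.height_ne_zero j (by lia)
  have h2 : ∑ i, (rootSign B i - rootSign B (P.reflectionPerm j i)) * P.pairing j i = 8 := by
    rw [← Finset.sum_subset (Finset.subset_univ {j, P.reflectionPerm j j}), Finset.sum_pair hne]
    · have hj1 := rootSign_of_isPos (B.isPos_of_mem_support hj)
      rw [RootPairing.reflectionPerm_self, rootSign_neg, hj1,
        RootPairing.pairing_reflectionPerm_self_right, RootPairing.pairing_same]
      norm_num
    · intro i _ hi
      simp only [Finset.mem_insert, Finset.mem_singleton, not_or] at hi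
      rw [rootSign_reflectionPerm B hj hi.1 hi.2, sub_self, zero_mul]
  simp only [sub_mul, Finset.sum_sub_distrib] at h2
  linarith

/-- A nonnegative combination of simple coroots pairs nonnegatively with ρ, and a coroot is a
positive multiple of its root. This makes signs in the dual root system agree with signs in the
original one. -/
theorem IsEuclidean.height_flip_pos (hP : IsEuclidean P) [P.IsRootSystem] (B : P.Base) {i : ι}
    (hi : 0 < B.flip.height i) : 0 < B.height i := by
  obtain ⟨f, -, hf0, hf⟩ := B.flip.exists_root_eq_sum_int i
  have hf1 : 0 < f := by
    refine hf0.resolve_right fun h ↦ ?_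
    rw [RootPairing.Base.height_eq_sum hf] at hi
    exact absurd hi (not_lt.mpr (Finset.sum_nonpos fun j _ ↦ h.le j))
  have h1 : 0 ≤ ⟪P.coroot i, rhoCheck B⟫ := by
    change P.coroot i = _ at hf
    rw [hf, sum_inner]
    refine Finset.sum_nonneg fun j hj ↦ ?_
    rw [← Int.cast_smul_eq_zsmul ℝ, real_inner_smul_left]
    refine mul_nonneg (by exact_mod_cast hf1.le j) ?_
    rw [RootPairing.flip_root, real_inner_comm, hP.inner_coroot,
      real_inner_comm (P.root j) (rhoCheck B), hP.inner_simpleRoot_rhoCheck B hj]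
    have := inner_root_self_pos P j
    positivity
  rw [real_inner_comm, hP.inner_coroot, real_inner_comm (P.root i) (rhoCheck B), hP.inner_root_rhoCheck B] at h1
  have h2 : 0 < 2 / ⟪P.root i, P.root i⟫ := by
    have := inner_root_self_pos P i
    positivity
  have h3 : (0 : ℝ) ≤ B.height i := nonneg_of_mul_nonneg_right h1 h2
  have h4 : 0 ≤ B.height i := by exact_mod_cast h3
  exact lt_of_le_of_ne h4 (B.height_ne_zero i).symm

theorem IsEuclidean.rootSign_flip (hP : IsEuclidean P) [P.IsRootSystem] (B : P.Base) (i : ι) :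
    rootSign B.flip i = rootSign B i := by
  rcases isPos_or_isPos_neg B.flip i with hi | hi
  · rw [rootSign_of_isPos hi, rootSign_of_isPos (hP.height_flip_pos B hi)]
  · have h1 := rootSign_of_isPos hi
    have h2 := rootSign_of_isPos (B := B) (hP.height_flip_pos B hi)
    rw [rootSign_neg] at h1
    change rootSign B (P.reflectionPerm i i) = 1 at h2
    rw [rootSign_neg] at h2
    linarith

end Basics

/-! ### Operators commuting with the Weyl group -/

section Invariants

variable {ι V : Type*} [NormedAddCommGroup V] [InnerProductSpace ℝ V]
  {P : RootPairing ι ℝ V V}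

theorem finiteDimensional_of_isRootSystem [Finite ι] (P : RootPairing ι ℝ V V) [P.IsRootSystem] :
    FiniteDimensional ℝ V := by
  have h : (⊤ : Submodule ℝ V).FG := by
    rw [← RootPairing.IsRootSystem.span_root_eq_top (P := P)]
    exact Submodule.fg_span (Set.finite_range _)
  exact Module.finite_def.mpr h

/-- Schur's lemma for the operator `x ↦ ∑ᵢ fᵢ ⟪x, αᵢ⟫ αᵢ`, where `f` is constant on the orbits of the
Weyl group. -/
theorem IsEuclidean.exists_sum_smul_eq_smul (hP : IsEuclidean P) [Fintype ι] [P.IsRootSystem]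
    [P.IsIrreducible] (f : ι → ℝ) (hf : ∀ i j, f (P.reflectionPerm j i) = f i) :
    ∃ c : ℝ, ∀ x, ∑ i, (f i * ⟪x, P.root i⟫) • P.root i = c • x := by
  have := finiteDimensional_of_isRootSystem P
  have := RootPairing.IsIrreducible.nontrivial P
  let T : V →ₗ[ℝ] V :=
    { toFun x := ∑ i, (f i * ⟪x, P.root i⟫) • P.root i
      map_add' x y := by
        simp only [inner_add_left, mul_add, add_smul, Finset.sum_add_distrib]
      map_smul' a x := by
        simp only [real_inner_smul_left, Finset.smul_sum, smul_smul, RingHom.id_apply]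
        exact Finset.sum_congr rfl fun i _ ↦ by ring_nf }
  have hT (x : V) : T x = ∑ i, (f i * ⟪x, P.root i⟫) • P.root i := rfl
  have hsymm : T.IsSymmetric := fun x y ↦ by
    simp only [hT, sum_inner, inner_sum, real_inner_smul_left, real_inner_smul_right]
    exact Finset.sum_congr rfl fun i _ ↦ by rw [real_inner_comm y]; ring
  obtain ⟨c, hc⟩ : ∃ c, Module.End.HasEigenvalue T c :=
    ⟨_, hsymm.hasEigenvalue_iSup_of_finiteDimensional⟩
  have hcomm (j : ι) (x : V) : T (P.reflection j x) = P.reflection j (T x) := by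
    rw [hT, hT, map_sum, ← Equiv.sum_comp (P.reflectionPerm j)]
    refine Finset.sum_congr rfl fun i _ ↦ ?_
    rw [hf, P.root_reflectionPerm, hP.inner_reflection_reflection, map_smul]
  have htop := RootPairing.IsIrreducible.eq_top_of_invtSubmodule_reflection (P := P)
    (Module.End.eigenspace T c) (fun j ↦ by
      rw [Module.End.mem_invtSubmodule]
      intro x hx
      rw [Module.End.mem_eigenspace_iff] at hx
      rw [Submodule.mem_comap, Module.End.mem_eigenspace_iff, LinearEquiv.coe_coe, hcomm, hx,
        map_smul]) hc
  refine ⟨c, fun x ↦ ?_⟩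
  have hx : x ∈ Module.End.eigenspace T c := htop ▸ Submodule.mem_top
  exact Module.End.mem_eigenspace_iff.mp hx

/-- Both sides are the trace of the scalar operator, computed in an orthonormal basis. -/
theorem mul_finrank_eq_sum [Fintype ι] [FiniteDimensional ℝ V] (u : ι → V) (f : ι → ℝ) {c : ℝ}
    (hc : ∀ x, ∑ i, (f i * ⟪x, u i⟫) • u i = c • x) :
    c * Module.finrank ℝ V = ∑ i, f i * ⟪u i, u i⟫ := by
  let e := stdOrthonormalBasis ℝ V
  have h1 (k) : c = ∑ i, f i * ⟪e k, u i⟫ ^ 2 := by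
    have h := congrArg (fun y ↦ ⟪y, e k⟫) (hc (e k))
    simp only [sum_inner, real_inner_smul_left, real_inner_self_eq_norm_sq, e.norm_eq_one] at h
    rw [show c = c * 1 ^ 2 by ring, ← h]
    exact Finset.sum_congr rfl fun i _ ↦ by rw [real_inner_comm]; ring
  have h2 : ∑ k, ∑ i, f i * ⟪e k, u i⟫ ^ 2 = ∑ k : Fin (Module.finrank ℝ V), c :=
    Finset.sum_congr rfl fun k _ ↦ (h1 k).symm
  rw [Finset.sum_comm] at h2
  simp only [← Finset.mul_sum, e.sum_sq_inner_right, Finset.sum_const, Finset.card_univ,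
    Fintype.card_fin, nsmul_eq_mul] at h2
  rw [mul_comm, ← h2]
  simp only [real_inner_self_eq_norm_sq]

end Invariants

/-! ### Properties of the highest root -/

section HighestRoot

variable {ι V : Type*} [NormedAddCommGroup V] [InnerProductSpace ℝ V]
  {P : RootPairing ι ℝ V V}

theorem pairingIn_pos_iff (hP : IsEuclidean P) [P.IsCrystallographic] (i j : ι) :
    0 < P.pairingIn ℤ i j ↔ 0 < ⟪P.root i, P.root j⟫ := by
  have h := hP.two_mul_inner_root i j
  rw [← P.algebraMap_pairingIn ℤ i j, eq_intCast] at h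
  have h0 := inner_root_self_pos P j
  rw [← Int.cast_pos (R := ℝ), ← mul_pos_iff_of_pos_right h0, ← h]
  simp

theorem pairingIn_nonneg_iff (hP : IsEuclidean P) [P.IsCrystallographic] (i j : ι) :
    0 ≤ P.pairingIn ℤ i j ↔ 0 ≤ ⟪P.root i, P.root j⟫ := by
  have h := hP.two_mul_inner_root i j
  rw [← P.algebraMap_pairingIn ℤ i j, eq_intCast] at h
  have h0 := inner_root_self_pos P j
  rw [← Int.cast_nonneg_iff (R := ℝ), ← mul_nonneg_iff_of_pos_right h0, ← h]
  simp

theorem exists_nonneg_coeff {B : P.Base} {i : ι} (hi : B.IsPos i) :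
    ∃ f : ι → ℤ, 0 ≤ f ∧ P.root i = ∑ j ∈ B.support, (f j : ℝ) • P.root j := by
  obtain ⟨f, -, hf0, hf⟩ := B.exists_root_eq_sum_int i
  refine ⟨f, (hf0.resolve_right fun h ↦ ?_).le, by simpa [Int.cast_smul_eq_zsmul] using hf⟩
  rw [RootPairing.Base.isPos_iff, RootPairing.Base.height_eq_sum hf] at hi
  exact absurd hi (not_lt.mpr (Finset.sum_nonpos fun j _ ↦ h.le j))

theorem inner_nonneg_of_isPos {B : P.Base} {x : V} (hx : ∀ j ∈ B.support, 0 ≤ ⟪x, P.root j⟫)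
    {i : ι} (hi : B.IsPos i) : 0 ≤ ⟪x, P.root i⟫ := by
  obtain ⟨f, hf0, hf⟩ := exists_nonneg_coeff hi
  rw [hf, inner_sum]
  refine Finset.sum_nonneg fun j hj ↦ ?_
  rw [real_inner_smul_right]
  exact mul_nonneg (by exact_mod_cast hf0 j) (hx j hj)

theorem isPos_highestRoot [Finite ι] [Nonempty ι] (B : P.Base) : B.IsPos (highestRoot B) := by
  obtain ⟨j, hj⟩ := B.support_nonempty
  have := height_le_height_highestRoot B j
  rw [B.height_one_of_mem_support hj] at this
  rw [RootPairing.Base.isPos_iff]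
  lia

theorem highestRoot_maximal [Finite ι] [Nonempty ι] (B : P.Base) (j k : ι) (hj : B.IsPos j) :
    P.root k ≠ P.root (highestRoot B) + P.root j := fun h ↦ by
  have h1 := B.height_add h
  have h2 := height_le_height_highestRoot B k
  rw [RootPairing.Base.isPos_iff] at hj
  lia

theorem coxeterNumber_eq [Finite ι] [Nonempty ι] (B : P.Base) :
    (coxeterNumber B : ℤ) = B.height (highestRoot B) + 1 := by
  have h := B.isPos_iff.mp (isPos_highestRoot B)
  rw [coxeterNumber, Nat.cast_add, Int.toNat_of_nonneg h.le, Nat.cast_one]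

theorem pairingIn_nonneg_of_maximal [Finite ι] [P.IsCrystallographic] {B : P.Base} {i : ι} (hi : B.IsPos i)
    (hmax : ∀ j k, B.IsPos j → P.root k ≠ P.root i + P.root j) {j : ι} (hj : j ∈ B.support) :
    0 ≤ P.pairingIn ℤ i j := by
  by_contra! h
  obtain ⟨k, hk⟩ := P.root_add_root_mem_of_pairingIn_neg h fun h' ↦ by
    have h1 : i = P.reflectionPerm j j := P.root_eq_neg_iff.mp h'
    rw [h1, RootPairing.Base.isPos_iff, height_neg, B.height_one_of_mem_support hj] at hi
    lia
  exact hmax j k (B.isPos_of_mem_support hj) hk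

variable [Finite ι] [P.IsCrystallographic]

theorem IsEuclidean.inner_highestRoot_nonneg [Nonempty ι] (hP : IsEuclidean P) (B : P.Base) {j : ι}
    (hj : j ∈ B.support) : 0 ≤ ⟪P.root (highestRoot B), P.root j⟫ :=
  (pairingIn_nonneg_iff hP _ _).mp
    (pairingIn_nonneg_of_maximal (isPos_highestRoot B) (highestRoot_maximal B) hj)

variable [P.IsReduced]

/-- A positive root to which no positive root can be added has full support. -/
theorem coeff_pos_of_maximal [P.IsIrreducible] (B : P.Base) {i : ι}
    {f : ι → ℤ} (hf0 : 0 ≤ f) (hf : P.root i = ∑ j ∈ B.support, (f j : ℝ) • P.root j)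
    (hdom : ∀ j ∈ B.support, 0 ≤ P.pairingIn ℤ i j) {j : ι} (hj : j ∈ B.support) : 0 < f j := by
  obtain ⟨k, hk, hk0⟩ : ∃ k ∈ B.support, 0 < f k := by
    by_contra! h
    refine P.ne_zero i ?_
    rw [hf]
    refine Finset.sum_eq_zero fun k hk ↦ ?_
    rw [le_antisymm (h k hk) (hf0 k), Int.cast_zero, zero_smul]
  -- Positivity spreads along the Dynkin diagram: if a neighbour l of k had coefficient 0 while k
  -- has a positive one, the pairing of the root with αₗ^∨ would be negative.
  refine B.induction_on_cartanMatrix (fun k : B.support ↦ 0 < f k) (i := ⟨k, hk⟩) (j := ⟨j, hj⟩)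
    hk0 ?_
  rintro ⟨k, hk⟩ ⟨l, hl⟩ hpk hlk
  by_contra hfl
  have hfl0 : f l = 0 := le_antisymm (not_lt.mp hfl) (hf0 l)
  have hpair : P.pairingIn ℤ i l = ∑ m ∈ B.support, f m * P.pairingIn ℤ m l := by
    have h : (P.pairingIn ℤ i l : ℝ) = ∑ m ∈ B.support, (f m : ℝ) * (P.pairingIn ℤ m l : ℝ) := by
      simp only [← eq_intCast (algebraMap ℤ ℝ) (P.pairingIn ℤ _ _), P.algebraMap_pairingIn,
        ← RootPairing.root_coroot_eq_pairing]
      rw [hf]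
      simp
    exact_mod_cast h
  have hle : ∀ m ∈ B.support, f m * P.pairingIn ℤ m l ≤ 0 := fun m hm ↦ by
    rcases eq_or_ne m l with rfl | hne
    · simp [hfl0]
    · exact mul_nonpos_of_nonneg_of_nonpos (hf0 m) (B.pairingIn_le_zero_of_ne hne hm hl)
  have hlt : f k * P.pairingIn ℤ k l < 0 := by
    have hne : k ≠ l := by
      rintro rfl
      exact hfl hpk
    refine mul_neg_of_pos_of_neg hpk
      (lt_of_le_of_ne (B.pairingIn_le_zero_of_ne hne hk hl) fun h ↦ hlk ?_)
    rw [B.cartanMatrix_apply_eq_zero_iff_symm]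
    exact h
  have := Finset.sum_neg' hle ⟨k, hk, hlt⟩
  have := hdom l hl
  lia

variable [Nonempty ι]

/-- Full support of the maximal root makes its inner product with the highest root positive. If they
differed, their difference would be a root, and whichever sign it has, it could be added to one of
the two. -/
theorem IsEuclidean.eq_highestRoot_of_maximal (hP : IsEuclidean P) [P.IsIrreducible] {B : P.Base}
    {i : ι} (hi : B.IsPos i) (hmax : ∀ j k, B.IsPos j → P.root k ≠ P.root i + P.root j) :
    i = highestRoot B := by
  by_contra hne
  obtain ⟨f, hf0, hf⟩ := exists_nonneg_coeff hi
  have hfpos := fun j hj ↦ coeff_pos_of_maximal B hf0 hf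
    (fun j hj ↦ pairingIn_nonneg_of_maximal hi hmax hj) (j := j) hj
  have hpos : 0 < P.pairingIn ℤ i (highestRoot B) := by
    rw [pairingIn_pos_iff hP, hf, sum_inner]
    simp only [real_inner_smul_left]
    obtain ⟨l, hl, hl0⟩ := (isPos_highestRoot B).exists_mem_support_pos_pairingIn
    refine Finset.sum_pos' (fun j hj ↦ ?_) ⟨l, hl, ?_⟩
    · rw [real_inner_comm]
      exact mul_nonneg (by exact_mod_cast hf0 j) (hP.inner_highestRoot_nonneg B hj)
    · exact mul_pos (by exact_mod_cast hfpos l hl) ((pairingIn_pos_iff hP _ _).mp hl0)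
  obtain ⟨k, hk⟩ := P.root_sub_root_mem_of_pairingIn_pos hpos hne
  rcases isPos_or_isPos_neg B k with hk' | hk'
  · exact highestRoot_maximal B k i hk' (by rw [hk]; abel)
  · refine hmax _ (highestRoot B) hk' ?_
    rw [root_neg, hk]
    abel

/-- The highest root dominates every root on the dominant chamber. -/
theorem IsEuclidean.inner_le_inner_highestRoot (hP : IsEuclidean P) [P.IsIrreducible] (B : P.Base)
    {x : V} (hx : ∀ j ∈ B.support, 0 ≤ ⟪x, P.root j⟫) (i : ι) :
    ⟪x, P.root i⟫ ≤ ⟪x, P.root (highestRoot B)⟫ := by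
  have key : ∀ (m : ℕ) (i : ι), B.IsPos i → (B.height (highestRoot B) - B.height i).toNat = m →
      ⟪x, P.root i⟫ ≤ ⟪x, P.root (highestRoot B)⟫ := by
    intro m
    induction m using Nat.strong_induction_on with
    | _ m ih =>
      intro i hi hm
      by_cases hmax : ∀ j k, B.IsPos j → P.root k ≠ P.root i + P.root j
      · rw [hP.eq_highestRoot_of_maximal hi hmax]
      · push Not at hmax
        obtain ⟨j, k, hj, hk⟩ := hmax
        have hjx := inner_nonneg_of_isPos hx hj
        have hkh := B.height_add hk
        have hkle := height_le_height_highestRoot B k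
        have hj' := B.isPos_iff.mp hj
        have h := ih _ (by lia) k (hi.add hj hk) rfl
        rw [hk, inner_add_right] at h
        linarith
  rcases isPos_or_isPos_neg B i with hi | hi
  · exact key _ i hi rfl
  · have h1 := inner_nonneg_of_isPos hx hi
    have h2 := inner_nonneg_of_isPos hx (isPos_highestRoot B)
    rw [root_neg, inner_neg_right] at h1
    linarith

/-- Among the roots of the given length one of maximal height, α, is dominant, since a simple
reflection cannot raise its height. Then ⟪α, α⟫ ≤ ⟪α, θ⟫ ≤ ⟪θ, θ⟫ by two uses of dominance. -/
theorem IsEuclidean.inner_root_self_le (hP : IsEuclidean P) [P.IsIrreducible] (B : P.Base)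
    (i : ι) : ⟪P.root i, P.root i⟫ ≤ ⟪P.root (highestRoot B), P.root (highestRoot B)⟫ := by
  have : Nonempty {k // ⟪P.root k, P.root k⟫ = ⟪P.root i, P.root i⟫} := ⟨⟨i, rfl⟩⟩
  obtain ⟨⟨k, hk⟩, hmax⟩ := Finite.exists_max
    (fun k : {k // ⟪P.root k, P.root k⟫ = ⟪P.root i, P.root i⟫} ↦ B.height k)
  have hdom : ∀ j ∈ B.support, 0 ≤ ⟪P.root k, P.root j⟫ := by
    intro j hj
    rw [← pairingIn_nonneg_iff hP]
    have h := hmax ⟨P.reflectionPerm j k, by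
      rw [P.root_reflectionPerm, hP.inner_reflection_reflection, hk]⟩
    rw [height_reflectionPerm, B.height_one_of_mem_support hj] at h
    simp only at h
    lia
  have h1 := hP.inner_le_inner_highestRoot B hdom k
  have h2 := hP.inner_le_inner_highestRoot B (fun j hj ↦ hP.inner_highestRoot_nonneg B hj) k
  rw [real_inner_comm] at h2
  linarith

theorem IsEuclidean.pairing_highestRoot_of_isPos (hP : IsEuclidean P) [P.IsIrreducible]
    (B : P.Base) {i : ι} (hi : B.IsPos i) (hne : i ≠ highestRoot B) :
    P.pairing i (highestRoot B) = 0 ∨ P.pairing i (highestRoot B) = 1 := by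
  have h0 : 0 ≤ P.pairingIn ℤ i (highestRoot B) := by
    rw [pairingIn_nonneg_iff hP, real_inner_comm]
    exact inner_nonneg_of_isPos (fun j hj ↦ hP.inner_highestRoot_nonneg B hj) hi
  have hlt : P.pairingIn ℤ i (highestRoot B) < 2 := by
    by_contra! h
    have h1 := hP.two_mul_inner_root i (highestRoot B)
    rw [← P.algebraMap_pairingIn ℤ, eq_intCast] at h1
    have h2 : (2 : ℝ) ≤ P.pairingIn ℤ i (highestRoot B) := by exact_mod_cast h
    have h3 := inner_root_self_pos P (highestRoot B)
    have h4 := hP.inner_root_self_le B i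
    -- Pairing at least 2 means ⟪α, θ⟫ ≥ ⟪θ, θ⟫; as θ is longest, |α − θ|² ≤ 0.
    have h5 : ⟪P.root i - P.root (highestRoot B), P.root i - P.root (highestRoot B)⟫ ≤ 0 := by
      rw [real_inner_sub_sub_self]
      nlinarith
    rw [real_inner_self_nonpos, sub_eq_zero] at h5
    exact hne (P.root.injective h5)
  rw [← P.algebraMap_pairingIn ℤ, eq_intCast]
  norm_cast
  lia

theorem IsEuclidean.pairing_highestRoot_eq_zero_or (hP : IsEuclidean P) [P.IsIrreducible]
    (B : P.Base) (i : ι) (hne : i ≠ highestRoot B)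
    (hne' : i ≠ P.reflectionPerm (highestRoot B) (highestRoot B)) :
    P.pairing i (highestRoot B) = 0 ∨ P.pairing i (highestRoot B) = rootSign B i := by
  rcases isPos_or_isPos_neg B i with hi | hi
  · rw [rootSign_of_isPos hi]
    exact hP.pairing_highestRoot_of_isPos B hi hne
  · have h := hP.pairing_highestRoot_of_isPos B hi fun h ↦ hne' (P.root.injective (by
      rw [root_neg, ← h, root_neg, neg_neg]))
    have h1 := rootSign_of_isPos hi
    rw [rootSign_neg] at h1
    rw [RootPairing.pairing_reflectionPerm_self_left] at h
    rcases h with h | h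
    · left; linarith
    · right; linarith

end HighestRoot

/-! ### Sums of signs over a rotation of rank-two roots -/

section SignSums

/-- The effect on `(ht α, ht β, ⟨α, β⟩, ⟨β, α⟩)` of replacing a pair of roots `(α, β)` by
`(β, -s_β α)`. -/
def rotate (s : ℤ × ℤ × ℤ × ℤ) : ℤ × ℤ × ℤ × ℤ :=
  (s.2.1, s.2.2.1 * s.2.1 - s.1, s.2.2.2, s.2.2.1)

-- After normalizing lengths, `rotate` turns the plane of α and β by the angle between them. For an
-- acute angle the roots visited run once around the plane in 6, 8 or 12 steps and change sign
-- exactly twice per turn; an obtuse angle reduces to this by negating every other root. Negating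
-- both roots leaves the product of signs unchanged, so its period divides 2, 3, 4 or 6, and 12 is a
-- common multiple. The sum is therefore independent of the base.
set_option maxHeartbeats 2000000 in
theorem sum_sign_rotate {x y a a' : ℤ} (h : ∀ t, (rotate^[t] (x, y, a, a')).1 ≠ 0)
    (ha : (a, a') ∈ ({(0, 0), (1, 1), (-1, -1), (1, 2), (2, 1), (-1, -2), (-2, -1), (1, 3),
      (3, 1), (-1, -3), (-3, -1)} : Set (ℤ × ℤ))) :
    ∑ t ∈ Finset.range 12, (rotate^[t] (x, y, a, a')).1.sign *
      (rotate^[t] (x, y, a, a')).2.1.sign = 2 * (a + a') := by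
  have h0 := h 0
  have h1 := h 1
  have h2 := h 2
  have h3 := h 3
  have h4 := h 4
  have h5 := h 5
  clear h
  simp only [Set.mem_insert_iff, Set.mem_singleton_iff, Prod.mk.injEq] at ha
  simp only [Finset.sum_range_succ, Finset.sum_range_zero, Function.iterate_succ,
    Function.iterate_zero, Function.comp_apply, id_eq, rotate] at h0 h1 h2 h3 h4 h5 ⊢
  rcases ha with ⟨rfl, rfl⟩ | ⟨rfl, rfl⟩ | ⟨rfl, rfl⟩ | ⟨rfl, rfl⟩ | ⟨rfl, rfl⟩ | ⟨rfl, rfl⟩ |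
      ⟨rfl, rfl⟩ | ⟨rfl, rfl⟩ | ⟨rfl, rfl⟩ | ⟨rfl, rfl⟩ | ⟨rfl, rfl⟩ <;>
    rcases lt_or_gt_of_ne h0 with k0 | k0 <;> rcases lt_or_gt_of_ne h1 with k1 | k1 <;>
    rcases lt_or_gt_of_ne h2 with k2 | k2 <;> (try (exfalso; omega)) <;>
    rcases lt_or_gt_of_ne h3 with k3 | k3 <;> (try (exfalso; omega)) <;>
    rcases lt_or_gt_of_ne h4 with k4 | k4 <;> (try (exfalso; omega)) <;>
    rcases lt_or_gt_of_ne h5 with k5 | k5 <;> (try (exfalso; omega)) <;>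
    simp (disch := omega) only [Int.sign_eq_one_of_pos, Int.sign_eq_neg_one_of_neg] <;> rfl

end SignSums

/-! ### The strange formula -/

section StrangeFormula

variable {ι V : Type*} [NormedAddCommGroup V] [InnerProductSpace ℝ V]
  {P : RootPairing ι ℝ V V}

theorem reflectionPerm_neg_neg (P : RootPairing ι ℝ V V) (i : ι) :
    P.reflectionPerm (P.reflectionPerm i i) (P.reflectionPerm i i) = i :=
  P.root.injective (by rw [root_neg, root_neg, neg_neg])

/-- The permutation `(α, β) ↦ (β, -s_β α)` of the set of pairs of roots. -/
def rotatePair (P : RootPairing ι ℝ V V) : Equiv.Perm (ι × ι) where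
  toFun p := (p.2, P.reflectionPerm (P.reflectionPerm p.2 p.1) (P.reflectionPerm p.2 p.1))
  invFun p := (P.reflectionPerm (P.reflectionPerm p.1 p.2) (P.reflectionPerm p.1 p.2), p.1)
  left_inv p := by
    refine Prod.ext ?_ rfl
    simp only [← reflectionPerm_neg, RootPairing.reflectionPerm_self]
  right_inv p := by
    refine Prod.ext rfl ?_
    simp only [← reflectionPerm_neg, RootPairing.reflectionPerm_self]

theorem IsEuclidean.inner_rotatePair (hP : IsEuclidean P) (p : ι × ι) :
    ⟪P.root (rotatePair P p).1, P.root (rotatePair P p).2⟫ = ⟪P.root p.1, P.root p.2⟫ := by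
  change ⟪P.root p.2, P.root (P.reflectionPerm (P.reflectionPerm p.2 p.1) _)⟫ = _
  rw [root_neg, inner_neg_right, P.root_reflectionPerm, ← hP.inner_reflection_left,
    P.reflection_apply_self, inner_neg_left, neg_neg, real_inner_comm]

/-- The heights and the pairings of a pair of roots. -/
noncomputable def pairData [P.IsCrystallographic] (B : P.Base) (p : ι × ι) : ℤ × ℤ × ℤ × ℤ :=
  (B.height p.1, B.height p.2, P.pairingIn ℤ p.1 p.2, P.pairingIn ℤ p.2 p.1)

theorem pairData_rotatePair [P.IsCrystallographic] (B : P.Base) (p : ι × ι) :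
    pairData B (rotatePair P p) = rotate (pairData B p) := by
  obtain ⟨i, j⟩ := p
  refine Prod.ext rfl (Prod.ext ?_ (Prod.ext ?_ ?_))
  · change B.height (P.reflectionPerm (P.reflectionPerm j i) (P.reflectionPerm j i)) =
      P.pairingIn ℤ i j * B.height j - B.height i
    rw [height_neg, height_reflectionPerm]
    ring
  · change P.pairingIn ℤ j (P.reflectionPerm (P.reflectionPerm j i) (P.reflectionPerm j i)) =
      P.pairingIn ℤ j i
    rw [P.pairingIn_reflectionPerm_self_right, P.pairingIn_reflectionPerm,
      P.pairingIn_reflectionPerm_self_left, neg_neg]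
  · change P.pairingIn ℤ (P.reflectionPerm (P.reflectionPerm j i) (P.reflectionPerm j i)) j =
      P.pairingIn ℤ i j
    rw [P.pairingIn_reflectionPerm_self_left, ← P.pairingIn_reflectionPerm,
      P.pairingIn_reflectionPerm_self_right, neg_neg]

theorem pairData_iterate_rotatePair [P.IsCrystallographic] (B : P.Base) (t : ℕ) (p : ι × ι) :
    pairData B ((rotatePair P)^[t] p) = rotate^[t] (pairData B p) :=
  Function.Semiconj.iterate_right (f := pairData B) (fun p ↦ pairData_rotatePair B p) t p

/-- The two corrections treat proportional roots: for β = ±α all twelve products equal ±1, giving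
±12, while the first term gives only ±8. -/
theorem sum_rootSign_rotatePair [Finite ι] [DecidableEq ι] [P.IsCrystallographic] [P.IsReduced]
    (B : P.Base) (p : ι × ι) :
    ∑ t ∈ Finset.range 12, rootSign B ((rotatePair P)^[t] p).1 *
      rootSign B ((rotatePair P)^[t] p).2 =
    2 * (P.pairing p.1 p.2 + P.pairing p.2 p.1) + (if p.2 = p.1 then 4 else 0) -
      (if p.2 = P.reflectionPerm p.1 p.1 then 4 else 0) := by
  have hsum : ∑ t ∈ Finset.range 12, rootSign B ((rotatePair P)^[t] p).1 *
      rootSign B ((rotatePair P)^[t] p).2 =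
      ((∑ t ∈ Finset.range 12, (rotate^[t] (pairData B p)).1.sign *
        (rotate^[t] (pairData B p)).2.1.sign : ℤ) : ℝ) := by
    push_cast
    refine Finset.sum_congr rfl fun t _ ↦ ?_
    rw [← pairData_iterate_rotatePair]
    rfl
  rw [hsum, ← P.algebraMap_pairingIn ℤ, ← P.algebraMap_pairingIn ℤ, eq_intCast, eq_intCast]
  obtain ⟨i, j⟩ := p
  have hh := B.height_ne_zero i
  have hsq : (B.height i).sign * (B.height i).sign = 1 := by
    rcases lt_or_gt_of_ne hh with h | h
    · rw [Int.sign_eq_neg_one_of_neg h]; rfl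
    · rw [Int.sign_eq_one_of_pos h]; rfl
  by_cases hij : j = i
  · obtain rfl : i = j := hij.symm
    have hne : i ≠ P.reflectionPerm i i := fun h ↦ hh (by
      have := height_neg B i
      rw [← h] at this
      lia)
    have hr : rotate (B.height i, B.height i, 2, 2) = (B.height i, B.height i, 2, 2) := by
      simp only [rotate, Prod.mk.injEq, and_true, true_and]
      ring
    simp only [pairData, P.pairingIn_same, Function.iterate_fixed hr, Finset.sum_const,
      Finset.card_range, if_true, if_neg hne, hsq]
    norm_num
  by_cases hij' : j = P.reflectionPerm i i
  · subst hij'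
    have hr (t : ℕ) : (rotate^[t] (B.height i, -B.height i, -2, -2)).1.sign *
        (rotate^[t] (B.height i, -B.height i, -2, -2)).2.1.sign = -1 := by
      have h2 : ∀ t, rotate^[t] (B.height i, -B.height i, -2, -2) =
          (B.height i, -B.height i, -2, -2) ∨
          rotate^[t] (B.height i, -B.height i, -2, -2) = (-B.height i, B.height i, -2, -2) := by
        intro t
        induction t with
        | zero => exact Or.inl rfl
        | succ t ih =>
          rw [Function.iterate_succ_apply']
          rcases ih with ih | ih <;> rw [ih] <;> simp only [rotate, Prod.mk.injEq, and_true] <;> lia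
      rcases h2 t with h | h <;> rw [h] <;>
        simp only [Int.sign_neg, mul_neg, neg_mul, hsq]
    simp only [pairData, height_neg, P.pairingIn_reflectionPerm_self_right,
      P.pairingIn_reflectionPerm_self_left, P.pairingIn_same, hr, Finset.sum_const,
      Finset.card_range, if_true, if_neg hij]
    norm_num
  · rw [if_neg hij, if_neg hij', pairData, sum_sign_rotate]
    · push_cast
      ring
    · intro t
      change (rotate^[t] (pairData B (i, j))).1 ≠ 0
      rw [← pairData_iterate_rotatePair]
      exact B.height_ne_zero _
    · exact P.pairingIn_pairingIn_mem_set_of_isCrystal_of_isRed' i j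
        (fun h ↦ hij (P.root.injective h).symm)
        fun h ↦ hij' (P.root.injective (by rw [root_neg, h, neg_neg]))

theorem IsEuclidean.inner_iterate_rotatePair (hP : IsEuclidean P) (t : ℕ) (p : ι × ι) :
    ⟪P.root ((rotatePair P)^[t] p).1, P.root ((rotatePair P)^[t] p).2⟫ =
      ⟪P.root p.1, P.root p.2⟫ := by
  induction t with
  | zero => rfl
  | succ t ih => rw [Function.iterate_succ_apply', hP.inner_rotatePair, ih]

/-- The strange formula of Freudenthal and de Vries, for the sum of the positive roots minus the
sum of the negative roots. -/
theorem IsEuclidean.inner_sum_rootSign_smul_root (hP : IsEuclidean P) [Fintype ι]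
    [P.IsRootSystem] [P.IsCrystallographic] [P.IsReduced] (B : P.Base) {c : ℝ}
    (hc : ∀ x, ∑ i, ⟪x, P.root i⟫ • P.root i = c • x) :
    ⟪∑ i, rootSign B i • P.root i, ∑ i, rootSign B i • P.root i⟫ =
      2 / 3 * c * (Fintype.card ι + Module.finrank ℝ V) := by
  classical
  have := finiteDimensional_of_isRootSystem P
  set E : ι × ι → ℝ := fun p ↦ rootSign B p.1 * rootSign B p.2
  set W : ι × ι → ℝ := fun p ↦ ⟪P.root p.1, P.root p.2⟫
  have h1 : ⟪∑ i, rootSign B i • P.root i, ∑ i, rootSign B i • P.root i⟫ = ∑ p, W p * E p := by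
    simp only [sum_inner, inner_sum, real_inner_smul_left, real_inner_smul_right,
      Fintype.sum_prod_type, E, W]
    exact Finset.sum_congr rfl fun i _ ↦ Finset.sum_congr rfl fun j _ ↦ by
      rw [real_inner_comm (P.root i)]
      ring
  -- The rotation permutes the pairs and preserves W, so E may be replaced by its average along the
  -- rotation, which involves only pairings.
  have h2 (t : ℕ) : ∑ p, W p * E ((rotatePair P)^[t] p) = ∑ p, W p * E p := by
    rw [← Equiv.sum_comp ((rotatePair P) ^ t) fun p ↦ W p * E p]
    refine Finset.sum_congr rfl fun p _ ↦ ?_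
    rw [Equiv.Perm.coe_pow]
    exact congrArg (· * _) (hP.inner_iterate_rotatePair t p).symm
  have h3 : 12 * ∑ p, W p * E p = ∑ p, W p * ∑ t ∈ Finset.range 12, E ((rotatePair P)^[t] p) := by
    simp only [Finset.mul_sum]
    rw [Finset.sum_comm]
    simp only [← Finset.mul_sum, h2]
    simp
  -- The scalar operator is applied to αᵢ and paired with αᵢ^∨.
  have h4 (i : ι) : ∑ j, W (j, i) * P.pairing j i = 2 * c := by
    have h := congrArg (fun y ↦ ⟪y, P.coroot i⟫) (hc (P.root i))
    simp only [sum_inner, real_inner_smul_left, hP.inner_root_coroot, P.pairing_same] at h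
    rw [mul_comm, ← h]
    exact Finset.sum_congr rfl fun j _ ↦ by rw [real_inner_comm]
  have h5 : ∑ p : ι × ι, W p * P.pairing p.1 p.2 = 2 * c * Fintype.card ι := by
    rw [Fintype.sum_prod_type_right]
    simp only [h4, Finset.sum_const, Finset.card_univ, nsmul_eq_mul]
    ring
  have h6 : ∑ p : ι × ι, W p * P.pairing p.2 p.1 = 2 * c * Fintype.card ι := by
    rw [← h5, ← Equiv.sum_comp (Equiv.prodComm ι ι)]
    exact Finset.sum_congr rfl fun p _ ↦ congrArg (· * _) (real_inner_comm _ _)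
  have h7 : c * Module.finrank ℝ V = ∑ i, ⟪P.root i, P.root i⟫ := by
    simpa using mul_finrank_eq_sum P.root (fun _ ↦ 1) (c := c) (by simpa using hc)
  have h8 : ∑ p : ι × ι, W p * (if p.2 = p.1 then 4 else 0) = 4 * (c * Module.finrank ℝ V) := by
    rw [Fintype.sum_prod_type, h7, Finset.mul_sum]
    exact Finset.sum_congr rfl fun i _ ↦ by simp [W, mul_comm]
  have h9 : ∑ p : ι × ι, W p * (if p.2 = P.reflectionPerm p.1 p.1 then 4 else 0) =
      -(4 * (c * Module.finrank ℝ V)) := by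
    rw [Fintype.sum_prod_type, h7, Finset.mul_sum, ← Finset.sum_neg_distrib]
    exact Finset.sum_congr rfl fun i _ ↦ by simp [W, mul_comm]
  simp only [E, sum_rootSign_rotatePair, mul_add, mul_sub, Finset.sum_add_distrib,
    Finset.sum_sub_distrib, h8, h9] at h3
  have h10 : ∑ p : ι × ι, W p * (2 * P.pairing p.1 p.2) = 2 * (2 * c * Fintype.card ι) := by
    rw [← h5, Finset.mul_sum]
    exact Finset.sum_congr rfl fun p _ ↦ by ring
  have h11 : ∑ p : ι × ι, W p * (2 * P.pairing p.2 p.1) = 2 * (2 * c * Fintype.card ι) := by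
    rw [← h6, Finset.mul_sum]
    exact Finset.sum_congr rfl fun p _ ↦ by ring
  rw [h10, h11] at h3
  rw [h1]
  linarith

end StrangeFormula

/-! ### Coxeter numbers and the norm of ρ -/

section Constants

variable {ι V : Type*} [Fintype ι] [Nonempty ι] [NormedAddCommGroup V] [InnerProductSpace ℝ V]
  {P : RootPairing ι ℝ V V} [P.IsCrystallographic] [P.IsReduced] [P.IsIrreducible]

/-- The pairing with θ^∨ can be replaced by the sign wherever it is nonzero, except at ±θ, where it
is ±2; these two roots give the correction. The linear sum of signs can then be evaluated through ρ,
which determines the scalars from Schur's lemma. -/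
theorem IsEuclidean.sum_mul_inner_highestRoot (hP : IsEuclidean P) (B : P.Base) (f : ι → ℝ)
    (hf : ∀ i, f (P.reflectionPerm i i) = f i) :
    ∑ i, f i * ⟪P.root i, P.root (highestRoot B)⟫ * P.pairing i (highestRoot B) =
      ∑ i, f i * ⟪P.root i, P.root (highestRoot B)⟫ * rootSign B i +
        2 * (f (highestRoot B) * ⟪P.root (highestRoot B), P.root (highestRoot B)⟫) := by
  classical
  set θ := highestRoot B
  have hne : θ ≠ P.reflectionPerm θ θ := fun h ↦ by
    have h' := height_neg B θ
    rw [← h] at h'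
    exact B.height_ne_zero θ (by lia)
  rw [← sub_eq_iff_eq_add', ← Finset.sum_sub_distrib,
    ← Finset.sum_subset (Finset.subset_univ {θ, P.reflectionPerm θ θ}), Finset.sum_pair hne]
  · have h1 := rootSign_of_isPos (isPos_highestRoot B)
    rw [hf, root_neg, rootSign_neg, h1, inner_neg_left, P.pairing_reflectionPerm_self_left,
      P.pairing_same]
    ring
  · intro i _ hi
    simp only [Finset.mem_insert, Finset.mem_singleton, not_or] at hi
    rcases hP.pairing_highestRoot_eq_zero_or B i hi.1 hi.2 with h | h
    · have h2 := hP.two_mul_inner_root i θ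
      rw [h, zero_mul, mul_eq_zero_iff_left two_ne_zero] at h2
      rw [h2]
      ring
    · rw [h, sub_self]

/-- The operator `∑ᵢ αᵢ ⊗ αᵢ^∨` is multiplication by twice the Coxeter number. -/
theorem IsEuclidean.sum_inner_smul_coroot (hP : IsEuclidean P) (B : P.Base) (x : V) :
    ∑ i, ⟪x, P.root i⟫ • P.coroot i = (2 * coxeterNumber B : ℝ) • x := by
  set f : ι → ℝ := fun i ↦ 2 / ⟪P.root i, P.root i⟫
  have hf (i j : ι) : f (P.reflectionPerm j i) = f i := by
    simp only [f, P.root_reflectionPerm, hP.inner_reflection_reflection]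
  obtain ⟨c, hc⟩ := hP.exists_sum_smul_eq_smul f hf
  have hfc (i : ι) (x : V) : (f i * ⟪x, P.root i⟫) • P.root i = ⟪x, P.root i⟫ • P.coroot i := by
    rw [hP.coroot_eq, smul_smul, mul_comm]
  simp only [hfc] at hc
  set θ := highestRoot B
  have h1 := hP.sum_mul_inner_highestRoot B f fun i ↦ hf i i
  have h2 := congrArg (fun y ↦ ⟪P.root θ, y⟫) (hP.sum_rootSign_smul_coroot B)
  have h3 := congrArg (fun y ↦ ⟪y, P.coroot θ⟫) (hc (P.root θ))
  simp only [inner_sum, sum_inner, real_inner_smul_left, real_inner_smul_right,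
    hP.inner_root_rhoCheck, hP.inner_root_coroot, P.pairing_same] at h2 h3
  have h4 : f θ * ⟪P.root θ, P.root θ⟫ = 2 := by
    have := (inner_root_self_pos P θ).ne'
    simp only [f]
    field_simp
  have hcn : (coxeterNumber B : ℝ) = B.height θ + 1 := by exact_mod_cast coxeterNumber_eq B
  have h5 : c = 2 * coxeterNumber B := by
    have h6 : ∑ i, f i * ⟪P.root i, P.root θ⟫ * P.pairing i θ = c * 2 := by
      rw [← h3]
      refine Finset.sum_congr rfl fun i _ ↦ ?_
      rw [hP.coroot_eq i, real_inner_smul_left, ← hP.inner_root_coroot, real_inner_comm (P.root θ)]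
      simp only [f]
      ring
    have h7 : ∑ i, f i * ⟪P.root i, P.root θ⟫ * rootSign B i = 4 * B.height θ := by
      rw [← h2]
      refine Finset.sum_congr rfl fun i _ ↦ ?_
      rw [← hP.inner_root_coroot, hP.inner_coroot, real_inner_comm (P.root θ)]
      simp only [f]
      ring
    rw [h6, h7, h4] at h1
    linarith
  rw [hc, h5]

theorem IsEuclidean.card_eq (hP : IsEuclidean P) (B : P.Base) :
    (Fintype.card ι : ℝ) = coxeterNumber B * Module.finrank ℝ V := by
  have := finiteDimensional_of_isRootSystem P
  have h := mul_finrank_eq_sum P.root (fun i ↦ 2 / ⟪P.root i, P.root i⟫)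
    (c := 2 * coxeterNumber B) fun x ↦ by
      rw [← hP.sum_inner_smul_coroot B x]
      exact Finset.sum_congr rfl fun i _ ↦ by rw [hP.coroot_eq, smul_smul, mul_comm]
  have h2 (i : ι) : 2 / ⟪P.root i, P.root i⟫ * ⟪P.root i, P.root i⟫ = 2 := by
    have := (inner_root_self_pos P i).ne'
    field_simp
  simp only [h2, Finset.sum_const, Finset.card_univ, nsmul_eq_mul] at h
  linarith

/-- The highest root of the dual system is its longest, and the longest coroot belongs to a shortest
root. -/
theorem IsEuclidean.lengthRatio_eq (hP : IsEuclidean P) (B : P.Base) :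
    lengthRatio P = ⟪P.root (highestRoot B), P.root (highestRoot B)⟫ /
      ⟪P.root (highestRoot B.flip), P.root (highestRoot B.flip)⟫ := by
  have hsup : ⨆ i, ⟪P.root i, P.root i⟫ =
      ⟪P.root (highestRoot B), P.root (highestRoot B)⟫ :=
    le_antisymm (ciSup_le fun i ↦ hP.inner_root_self_le B i)
      (le_ciSup (f := fun i ↦ ⟪P.root i, P.root i⟫) (Set.finite_range _).bddAbove _)
  have hinf : ⨅ i, ⟪P.root i, P.root i⟫ =
      ⟪P.root (highestRoot B.flip), P.root (highestRoot B.flip)⟫ := by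
    refine le_antisymm
      (ciInf_le (f := fun i ↦ ⟪P.root i, P.root i⟫) (Set.finite_range _).bddBelow _)
      (le_ciInf fun i ↦ ?_)
    have h := hP.flip.inner_root_self_le B.flip i
    simp only [RootPairing.flip_root, hP.inner_coroot_self] at h
    exact (div_le_div_iff_of_pos_left (by norm_num) (inner_root_self_pos P i)
      (inner_root_self_pos P _)).mp h
  rw [lengthRatio, hsup, hinf]

/-- The Schur scalar is found by testing on the highest coroot γ^∨. With ⟪θ, θ⟫ = 2 it becomes 2 r
g, the scalar fed into the strange formula for the dual system. -/
theorem IsEuclidean.sum_inner_coroot_smul_coroot (hP : IsEuclidean P) (B : P.Base) (x : V) :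
    ∑ i, ⟪x, P.coroot i⟫ • P.coroot i = (4 * dualCoxeterNumber B.flip /
      ⟪P.root (highestRoot B.flip), P.root (highestRoot B.flip)⟫ : ℝ) • x := by
  obtain ⟨c, hc⟩ := hP.flip.exists_sum_smul_eq_smul (fun _ ↦ 1) fun _ _ ↦ rfl
  simp only [one_mul, RootPairing.flip_root] at hc
  set γ := highestRoot B.flip
  have h1 := hP.flip.sum_mul_inner_highestRoot B.flip (fun _ ↦ 1) fun i ↦ rfl
  have h2 := congrArg (fun y ↦ ⟪y, P.coroot γ⟫) (hP.sum_rootSign_smul_coroot B)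
  have h3 := congrArg (fun y ↦ ⟪y, P.root γ⟫) (hc (P.coroot γ))
  have h0 := (inner_root_self_pos P γ).ne'
  simp only [sum_inner, real_inner_smul_left, real_inner_comm (P.root γ) (P.coroot _),
    hP.inner_root_coroot, P.pairing_same] at h2 h3
  rw [hP.inner_coroot, real_inner_comm (P.root γ) (rhoCheck B), hP.inner_root_rhoCheck] at h2
  simp only [one_mul, RootPairing.flip_root, RootPairing.pairing_flip, hP.rootSign_flip] at h1
  have h4 : ∑ i, ⟪P.coroot i, P.coroot γ⟫ * P.pairing γ i = c * 2 := by
    rw [← h3]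
    exact Finset.sum_congr rfl fun i _ ↦ by rw [real_inner_comm]
  have h5 : ∑ i, ⟪P.coroot i, P.coroot γ⟫ * rootSign B i =
      4 * (2 / ⟪P.root γ, P.root γ⟫ * B.height γ) := by
    rw [← h2]
    exact Finset.sum_congr rfl fun i _ ↦ by ring
  rw [show highestRoot B.flip = γ from rfl, h4, h5, hP.inner_coroot_self] at h1
  have hg : (dualCoxeterNumber B.flip : ℝ) = B.height γ + 1 := by
    rw [dualCoxeterNumber]
    push_cast
    rfl
  rw [hc, hg]
  congr 1
  linear_combination h1 / 2

theorem IsEuclidean.inner_rhoCheck_self (hP : IsEuclidean P) (B : P.Base)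
    (hnorm : ⟪P.root (highestRoot B), P.root (highestRoot B)⟫ = 2) :
    ⟪rhoCheck B, rhoCheck B⟫ = lengthRatio P * dualCoxeterNumber B.flip *
      Module.finrank ℝ V * (coxeterNumber B + 1) / 12 := by
  have h := hP.flip.inner_sum_rootSign_smul_root B.flip (hP.sum_inner_coroot_smul_coroot B)
  simp only [hP.rootSign_flip, RootPairing.flip_root, hP.sum_rootSign_smul_coroot,
    real_inner_smul_left, real_inner_smul_right] at h
  rw [hP.card_eq B] at h
  rw [hP.lengthRatio_eq B, hnorm]
  linear_combination h / 16

end Constants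

/-! ### Minuscule vectors in the coroot lattice -/

section Minuscule

variable {ι V : Type*} [NormedAddCommGroup V] [InnerProductSpace ℝ V]
  {P : RootPairing ι ℝ V V}

theorem IsEuclidean.exists_int_inner_root (hP : IsEuclidean P) [P.IsCrystallographic] {q : V}
    (hq : q ∈ P.corootSpan ℤ) (i : ι) : ∃ m : ℤ, ⟪q, P.root i⟫ = m := by
  induction hq using Submodule.span_induction with
  | mem x hx =>
    obtain ⟨j, rfl⟩ := hx
    exact ⟨P.pairingIn ℤ i j, by
      rw [real_inner_comm, hP.inner_root_coroot, ← P.algebraMap_pairingIn ℤ, eq_intCast]⟩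
  | zero => exact ⟨0, by simp⟩
  | add x y _ _ hx hy =>
    obtain ⟨m, hm⟩ := hx
    obtain ⟨n, hn⟩ := hy
    exact ⟨m + n, by rw [inner_add_left, hm, hn]; push_cast; rfl⟩
  | smul a x _ hx =>
    obtain ⟨m, hm⟩ := hx
    exact ⟨a * m, by rw [← Int.cast_smul_eq_zsmul ℝ, real_inner_smul_left, hm]; push_cast; rfl⟩

/-- Since negatives of coroots are coroots, no coefficients are needed; the length of the list is
then available for induction. -/
theorem exists_list_sum_coroot_eq {q : V} (hq : q ∈ P.corootSpan ℤ) :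
    ∃ l : List ι, (l.map P.coroot).sum = q := by
  have hneg (l : List ι) : ((l.map fun i ↦ P.reflectionPerm i i).map P.coroot).sum =
      -(l.map P.coroot).sum := by
    induction l with
    | nil => simp
    | cons i l ih =>
      simp only [List.map_cons, List.sum_cons, ih, coroot_neg, neg_add]
  have hnat (n : ℕ) (l : List ι) : ∃ l' : List ι, (l'.map P.coroot).sum =
      n • (l.map P.coroot).sum := by
    induction n with
    | zero => exact ⟨[], by simp⟩
    | succ n ih =>
      obtain ⟨l', hl'⟩ := ih
      exact ⟨l' ++ l, by rw [List.map_append, List.sum_append, hl', succ_nsmul]⟩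
  induction hq using Submodule.span_induction with
  | mem x hx =>
    obtain ⟨j, rfl⟩ := hx
    exact ⟨[j], by simp⟩
  | zero => exact ⟨[], by simp⟩
  | add x y _ _ hx hy =>
    obtain ⟨l, rfl⟩ := hx
    obtain ⟨l', rfl⟩ := hy
    exact ⟨l ++ l', by simp⟩
  | smul a x _ hx =>
    obtain ⟨l, rfl⟩ := hx
    obtain ⟨n, rfl | rfl⟩ := a.eq_nat_or_neg
    · obtain ⟨l', hl'⟩ := hnat n l
      exact ⟨l', by rw [hl', natCast_zsmul]⟩
    · obtain ⟨l', hl'⟩ := hnat n l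
      exact ⟨_, by rw [hneg, hl', neg_smul, natCast_zsmul]⟩

/-- The coroot lattice contains no nonzero minuscule vectors. -/
theorem IsEuclidean.eq_zero_of_abs_inner_le_one (hP : IsEuclidean P) [P.IsCrystallographic]
    {q : V} (hq : q ∈ P.corootSpan ℤ) (h : ∀ i, |⟪q, P.root i⟫| ≤ 1) : q = 0 := by
  classical
  obtain ⟨l, hl⟩ := exists_list_sum_coroot_eq hq
  generalize hn : l.length = n
  induction n using Nat.strong_induction_on generalizing q l with
  | _ n ih =>
    by_contra hq0
    have hpos : 0 < ⟪q, q⟫ := real_inner_self_pos.mpr hq0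
    -- Expanding ⟪q, q⟫ > 0 along the list, some summand is positive. Integrality and the bound 1
    -- then force ⟪q, αₖ⟫ = 1, so reflecting in αₖ subtracts exactly this coroot and shortens the
    -- list.
    obtain ⟨k, hk, hk0⟩ : ∃ k ∈ l, 0 < ⟪q, P.coroot k⟫ := by
      by_contra! hle
      have h1 : ∀ l' : List ι, (∀ k ∈ l', ⟪q, P.coroot k⟫ ≤ 0) →
          ⟪q, (l'.map P.coroot).sum⟫ ≤ 0 := by
        intro l' hl'
        induction l' with
        | nil => simp
        | cons i l' ih' =>
          rw [List.map_cons, List.sum_cons, inner_add_right]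
          have := ih' fun k hk ↦ hl' k (List.mem_cons_of_mem _ hk)
          have := hl' i List.mem_cons_self
          linarith
      have h2 := h1 l hle
      rw [hl] at h2
      linarith
    have hk1 : ⟪q, P.root k⟫ = 1 := by
      obtain ⟨m, hm⟩ := hP.exists_int_inner_root hq k
      rw [hP.inner_coroot] at hk0
      have h1 : 0 < 2 / ⟪P.root k, P.root k⟫ := by
        have := inner_root_self_pos P k
        positivity
      have h2 := pos_of_mul_pos_right hk0 h1.le
      have h3 := h k
      rw [hm] at h2 h3 ⊢
      norm_cast at h2 h3 ⊢
      rw [abs_le] at h3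
      lia
    have hrefl : P.reflection k q = q - P.coroot k := by
      rw [hP.reflection_apply, hk1, one_smul]
    have hsum : ((l.erase k).map P.coroot).sum = q - P.coroot k := by
      rw [← hl, ← List.sum_map_erase P.coroot hk, add_sub_cancel_left]
    have hzero : P.reflection k q = 0 := by
      refine ih (l.erase k).length ?_ (q := P.reflection k q) ?_ ?_ (l.erase k)
        (hsum.trans hrefl.symm) rfl
      · have := List.length_erase_of_mem hk
        have := List.length_pos_of_mem hk
        lia
      · rw [hrefl]
        exact sub_mem hq (Submodule.subset_span ⟨k, rfl⟩)
      · intro i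
        rw [hP.inner_reflection_left, ← P.root_reflectionPerm]
        exact h _
    exact hq0 (by simpa using hzero)

end Minuscule

/-! ### Words in the simple reflections -/

section WeylGroup

variable {ι V : Type*} [NormedAddCommGroup V] [InnerProductSpace ℝ V]
  {P : RootPairing ι ℝ V V}

/-- The group generated by the reflections in the simple roots. -/
def simpleWeylGroup (B : P.Base) : Subgroup (V ≃ₗ[ℝ] V) :=
  Subgroup.closure (P.reflection '' B.support)

theorem reflection_mem_simpleWeylGroup [Finite ι] [P.IsCrystallographic] [P.IsReduced]
    (B : P.Base) (i : ι) : P.reflection i ∈ simpleWeylGroup B := by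
  refine B.induction_reflect i (p := fun i ↦ P.reflection i ∈ simpleWeylGroup B) ?_
    (fun j hj ↦ Subgroup.subset_closure ⟨j, hj, rfl⟩) ?_
  · intro i hi
    rw [RootPairing.reflection_reflectionPerm]
    exact mul_mem (mul_mem hi hi) hi
  · intro i j hi hj
    have hj' : P.reflection j ∈ simpleWeylGroup B := Subgroup.subset_closure ⟨j, hj, rfl⟩
    rw [RootPairing.reflection_reflectionPerm]
    exact mul_mem (mul_mem hj' hi) hj'

/-- The permutation of the roots given by a product of reflections. -/
def wordPerm (P : RootPairing ι ℝ V V) (l : List ι) : Equiv.Perm ι :=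
  (l.map P.reflectionPerm).prod

theorem wordPerm_cons (i : ι) (l : List ι) :
    wordPerm P (i :: l) = P.reflectionPerm i * wordPerm P l := by
  simp [wordPerm]

theorem wordPerm_append (l l' : List ι) :
    wordPerm P (l ++ l') = wordPerm P l * wordPerm P l' := by
  simp [wordPerm]

theorem wordPerm_neg (l : List ι) (i : ι) :
    wordPerm P l (P.reflectionPerm i i) =
      P.reflectionPerm (wordPerm P l i) (wordPerm P l i) := by
  induction l with
  | nil => rfl
  | cons j l ih => simp only [wordPerm_cons, Equiv.Perm.mul_apply, ih, reflectionPerm_neg]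

theorem reflectionPerm_wordPerm (l : List ι) (i : ι) :
    P.reflectionPerm (wordPerm P l i) =
      wordPerm P l * P.reflectionPerm i * (wordPerm P l)⁻¹ := by
  induction l with
  | nil => simp [wordPerm]
  | cons j l ih =>
    have h (k : ι) : P.reflectionPerm (P.reflectionPerm j k) =
        P.reflectionPerm j * P.reflectionPerm k * P.reflectionPerm j := by
      ext m
      apply P.root.injective
      simp only [P.root_reflectionPerm, RootPairing.reflection_reflectionPerm,
        Equiv.Perm.mul_apply, LinearEquiv.mul_apply]
    rw [wordPerm_cons, Equiv.Perm.mul_apply, h, ih, mul_inv_rev, P.reflectionPerm_inv]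
    simp only [mul_assoc]

theorem exists_word_of_mem_simpleWeylGroup {B : P.Base} {v : V ≃ₗ[ℝ] V}
    (hv : v ∈ simpleWeylGroup B) :
    ∃ l : List ι, (∀ j ∈ l, j ∈ B.support) ∧ ∀ i, v (P.root i) = P.root (wordPerm P l i) := by
  induction hv using Subgroup.closure_induction with
  | mem x hx =>
    obtain ⟨j, hj, rfl⟩ := hx
    exact ⟨[j], by simpa using hj, fun i ↦ by simp [wordPerm]⟩
  | one => exact ⟨[], by simp, fun i ↦ by simp [wordPerm]⟩
  | mul x y _ _ hx hy =>
    obtain ⟨l, hl, hx⟩ := hx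
    obtain ⟨l', hl', hy⟩ := hy
    refine ⟨l ++ l', fun j hj ↦ (List.mem_append.mp hj).elim (hl j) (hl' j), fun i ↦ ?_⟩
    rw [LinearEquiv.mul_apply, hy, hx, wordPerm_append, Equiv.Perm.mul_apply]
  | inv x _ hx =>
    obtain ⟨l, hl, hx⟩ := hx
    refine ⟨l.reverse, fun j hj ↦ hl j (List.mem_reverse.mp hj), fun i ↦ ?_⟩
    have h : wordPerm P l.reverse = (wordPerm P l)⁻¹ := by
      simp only [wordPerm, List.prod_inv_reverse, List.map_reverse, List.map_map]
      congr 2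
      exact List.map_congr_left fun j _ ↦ (P.reflectionPerm_inv j).symm
    have h2 : x (P.root ((wordPerm P l)⁻¹ i)) = P.root i := by
      rw [hx]
      exact congrArg P.root ((wordPerm P l).apply_symm_apply i)
    rw [h, ← h2]
    exact x.symm_apply_apply _

theorem IsEuclidean.inner_map_map_of_mem (hP : IsEuclidean P) {B : P.Base} {v : V ≃ₗ[ℝ] V}
    (hv : v ∈ simpleWeylGroup B) (x y : V) : ⟪v x, v y⟫ = ⟪x, y⟫ := by
  induction hv using Subgroup.closure_induction generalizing x y with
  | mem z hz =>
    obtain ⟨j, -, rfl⟩ := hz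
    exact hP.inner_reflection_reflection j x y
  | one => rfl
  | mul z z' _ _ hz hz' => rw [LinearEquiv.mul_apply, LinearEquiv.mul_apply, hz, hz']
  | inv z _ hz =>
    rw [← hz]
    exact congrArg₂ _ (z.apply_symm_apply x) (z.apply_symm_apply y)

theorem IsEuclidean.map_mem_corootSpan (hP : IsEuclidean P) {B : P.Base} {v : V ≃ₗ[ℝ] V}
    (hv : v ∈ simpleWeylGroup B) {q : V} (hq : q ∈ P.corootSpan ℤ) : v q ∈ P.corootSpan ℤ := by
  obtain ⟨l, -, hl⟩ := exists_word_of_mem_simpleWeylGroup hv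
  have h (i : ι) : v (P.coroot i) = P.coroot (wordPerm P l i) := by
    rw [hP.coroot_eq, map_smul, hl, hP.coroot_eq, ← hl, hP.inner_map_map_of_mem hv]
  induction hq using Submodule.span_induction with
  | mem x hx =>
    obtain ⟨j, rfl⟩ := hx
    rw [h]
    exact Submodule.subset_span ⟨_, rfl⟩
  | zero => simp
  | add x y _ _ hx hy =>
    rw [map_add]
    exact add_mem hx hy
  | smul a x _ hx =>
    rw [map_zsmul]
    exact Submodule.smul_mem _ a hx

variable [Finite ι] [P.IsCrystallographic] [P.IsReduced]

/-- The exchange condition. -/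
theorem exists_shorter_word (B : P.Base) {k : ι} (hk : k ∈ B.support) (l : List ι)
    (hl : ∀ j ∈ l, j ∈ B.support) (hneg : ¬ B.IsPos (wordPerm P l k)) :
    ∃ l' : List ι, (∀ j ∈ l', j ∈ B.support) ∧ l'.length + 1 = l.length ∧
      wordPerm P l * P.reflectionPerm k = wordPerm P l' := by
  induction l with
  | nil => exact absurd (B.isPos_of_mem_support hk) (by simpa [wordPerm] using hneg)
  | cons j l ih =>
    have hlt : ∀ m ∈ l, m ∈ B.support := fun m hm ↦ hl m (List.mem_cons_of_mem _ hm)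
    by_cases hpos : B.IsPos (wordPerm P l k)
    · refine ⟨l, hlt, rfl, ?_⟩
      -- The only positive root made negative by a simple reflection is its own. So the first letter
      -- is the conjugate of sₖ by the rest of the word, and the two cancel.
      have hj : wordPerm P l k = j := by
        by_contra hne
        refine hneg ?_
        rw [wordPerm_cons, Equiv.Perm.mul_apply]
        exact hpos.reflectionPerm (hl j List.mem_cons_self) hne
      have h := reflectionPerm_wordPerm (P := P) l k
      rw [hj] at h
      have hsq : P.reflectionPerm k * P.reflectionPerm k = 1 := by
        rw [← sq, P.reflectionPerm_sq]
      rw [wordPerm_cons, h]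
      simp only [mul_assoc, inv_mul_cancel_left, hsq, mul_one]
    · obtain ⟨l', hl', hlen, h⟩ := ih hlt hpos
      refine ⟨j :: l', fun m hm ↦ ?_, by simp [hlen], ?_⟩
      · rcases List.mem_cons.mp hm with rfl | hm
        · exact hl m List.mem_cons_self
        · exact hl' m hm
      · rw [wordPerm_cons, wordPerm_cons, mul_assoc, h]

/-- If the word ends in k, the word without that letter makes αₖ negative, so the exchange condition
yields a word for the same permutation with two letters fewer. -/
theorem wordPerm_eq_one (B : P.Base) (l : List ι) (hl : ∀ j ∈ l, j ∈ B.support)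
    (hpos : ∀ j ∈ B.support, B.IsPos (wordPerm P l j)) : wordPerm P l = 1 := by
  generalize hn : l.length = n
  induction n using Nat.strong_induction_on generalizing l with
  | _ n ih =>
    rcases List.eq_nil_or_concat l with rfl | ⟨l₀, k, rfl⟩
    · rfl
    · have hk : k ∈ B.support := hl k (by simp)
      have hneg : ¬ B.IsPos (wordPerm P l₀ k) := by
        have h := hpos k hk
        rw [List.concat_eq_append, wordPerm_append, Equiv.Perm.mul_apply,
          show wordPerm P [k] k = P.reflectionPerm k k by simp [wordPerm], wordPerm_neg,
          RootPairing.Base.isPos_iff, height_neg] at h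
        rw [RootPairing.Base.isPos_iff]
        lia
      obtain ⟨l', hl', hlen, h⟩ :=
        exists_shorter_word B hk l₀ (fun j hj ↦ hl j (by simp [hj])) hneg
      have h2 : wordPerm P (l₀.concat k) = wordPerm P l' := by
        rw [← h, List.concat_eq_append, wordPerm_append]
        simp [wordPerm]
      rw [h2] at hpos ⊢
      exact ih _ (by simp at hn; lia) l' hl' hpos rfl

/-- An element of the Weyl group which maps the simple roots to positive roots is trivial. -/
theorem eq_one_of_isPos [P.IsRootSystem] {B : P.Base} {v : V ≃ₗ[ℝ] V}
    (hv : v ∈ simpleWeylGroup B)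
    (hpos : ∀ j ∈ B.support, ∀ k, v (P.root j) = P.root k → B.IsPos k) : v = 1 := by
  obtain ⟨l, hl, h⟩ := exists_word_of_mem_simpleWeylGroup hv
  have h1 := wordPerm_eq_one B l hl fun j hj ↦ hpos j hj _ (h j)
  refine LinearEquiv.toLinearMap_injective (B.toWeightBasis.ext fun j ↦ ?_)
  rw [B.toWeightBasis_apply, LinearEquiv.coe_coe, h, h1]
  rfl

end WeylGroup

/-! ### The affine Weyl group and the orbit of ρ / h -/

section AffineWeylGroup

variable {ι V : Type*} [NormedAddCommGroup V] [InnerProductSpace ℝ V]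
  {P : RootPairing ι ℝ V V}

/-- The pairing of `v ρ` with a root is the height of the preimage of the root under `v`. -/
theorem IsEuclidean.exists_inner_map_rhoCheck (hP : IsEuclidean P) [P.IsRootSystem] {B : P.Base}
    {v : V ≃ₗ[ℝ] V} (hv : v ∈ simpleWeylGroup B) (i : ι) :
    ∃ k, v (P.root k) = P.root i ∧ ⟪v (rhoCheck B), P.root i⟫ = B.height k := by
  obtain ⟨l, -, hl⟩ := exists_word_of_mem_simpleWeylGroup (inv_mem hv)
  have h : v (P.root (wordPerm P l i)) = P.root i := by
    rw [← hl]
    exact v.apply_symm_apply _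
  refine ⟨_, h, ?_⟩
  rw [← h, hP.inner_map_map_of_mem hv, real_inner_comm, hP.inner_root_rhoCheck]

variable [Finite ι] [Nonempty ι]

theorem affineReflection_mem_affineWeylGroup {B : P.Base} {j : ι} (hj : j ∈ B.support) :
    affineReflection P j 0 ∈ affineWeylGroup B :=
  Subgroup.subset_closure (Or.inl ⟨j, hj, rfl⟩)

theorem affineReflection_highestRoot_mem_affineWeylGroup (B : P.Base) :
    affineReflection P (highestRoot B) 1 ∈ affineWeylGroup B :=
  Subgroup.subset_closure (Or.inr rfl)

theorem coxeterNumber_pos (B : P.Base) : 0 < coxeterNumber B := Nat.succ_pos _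

theorem abs_height_lt_coxeterNumber (B : P.Base) (i : ι) : |B.height i| < coxeterNumber B := by
  have h1 := height_le_height_highestRoot B i
  have h2 := height_le_height_highestRoot B (P.reflectionPerm i i)
  rw [height_neg] at h2
  rw [abs_lt, coxeterNumber_eq]
  lia

variable [P.IsCrystallographic] [P.IsReduced]

theorem IsEuclidean.exists_linear_part (hP : IsEuclidean P) {B : P.Base} {w : V ≃ᵃ[ℝ] V}
    (hw : w ∈ affineWeylGroup B) :
    ∃ v ∈ simpleWeylGroup B, ∃ q ∈ P.corootSpan ℤ, ∀ x, w x = v x + q := by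
  have hrefl (i : ι) (k : ℝ) (x : V) :
      affineReflection P i k x = P.reflection i x + k • P.coroot i := by
    rw [affineReflection_apply hP, hP.reflection_apply, real_inner_comm]
    module
  induction hw using Subgroup.closure_induction with
  | mem x hx =>
    rcases hx with ⟨i, -, rfl⟩ | rfl
    · exact ⟨_, reflection_mem_simpleWeylGroup B i, 0, zero_mem _, fun x ↦ by
        rw [hrefl, zero_smul]⟩
    · exact ⟨_, reflection_mem_simpleWeylGroup B _, P.coroot (highestRoot B),
        Submodule.subset_span ⟨_, rfl⟩, fun x ↦ by rw [hrefl, one_smul]⟩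
  | one => exact ⟨1, one_mem _, 0, zero_mem _, fun x ↦ by simp⟩
  | mul w w' _ _ hw hw' =>
    obtain ⟨v, hv, q, hq, h⟩ := hw
    obtain ⟨v', hv', q', hq', h'⟩ := hw'
    refine ⟨v * v', mul_mem hv hv', v q' + q, add_mem (hP.map_mem_corootSpan hv hq') hq,
      fun x ↦ ?_⟩
    rw [AffineEquiv.mul_def, AffineEquiv.trans_apply, h', h, map_add, LinearEquiv.mul_apply,
      add_assoc]
  | inv w _ hw =>
    obtain ⟨v, hv, q, hq, h⟩ := hw
    refine ⟨v⁻¹, inv_mem hv, -(v⁻¹ q), neg_mem (hP.map_mem_corootSpan (inv_mem hv) hq),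
      fun x ↦ ?_⟩
    apply w.injective
    have hvv (y : V) : v (v⁻¹ y) = y := v.apply_symm_apply y
    rw [h (v⁻¹ x + -(v⁻¹ q)), map_add, map_neg, hvv, hvv, neg_add_cancel_right]
    exact w.apply_symm_apply x

theorem IsEuclidean.inner_sub_map_affine (hP : IsEuclidean P) {B : P.Base} {w : V ≃ᵃ[ℝ] V}
    (hw : w ∈ affineWeylGroup B) (x y : V) :
    ⟪w x - w y, w x - w y⟫ = ⟪x - y, x - y⟫ := by
  obtain ⟨v, hv, q, -, h⟩ := hP.exists_linear_part hw
  rw [h, h, add_sub_add_right_eq_sub, ← map_sub, hP.inner_map_map_of_mem hv]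

/-- The stabilizer in the affine Weyl group of the point `ρ / h` is trivial. -/
theorem IsEuclidean.eq_one_of_fixes (hP : IsEuclidean P) [P.IsRootSystem] {B : P.Base}
    {w : V ≃ᵃ[ℝ] V} (hw : w ∈ affineWeylGroup B)
    (hfix : w ((1 / (coxeterNumber B : ℝ)) • rhoCheck B) =
      (1 / (coxeterNumber B : ℝ)) • rhoCheck B) : w = 1 := by
  obtain ⟨v, hv, q, hq, h⟩ := hP.exists_linear_part hw
  have hh : (0 : ℝ) < coxeterNumber B := by exact_mod_cast coxeterNumber_pos B
  have hq' (i : ι) {k : ι} (hk : ⟪v (rhoCheck B), P.root i⟫ = B.height k) :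
      (coxeterNumber B : ℝ) * ⟪q, P.root i⟫ = B.height i - B.height k := by
    rw [h, map_smul] at hfix
    have h1 := congrArg (fun y ↦ ⟪y, P.root i⟫) hfix
    simp only [inner_add_left, real_inner_smul_left, hk] at h1
    rw [real_inner_comm (P.root i) (rhoCheck B), hP.inner_root_rhoCheck] at h1
    field_simp at h1
    linarith
  -- The number h⟪q, α⟫ is a difference of two heights, each less than h in absolute value, so the
  -- integer ⟪q, α⟫ is at most 1 in absolute value and the minuscule lemma applies.
  have hq0 : q = 0 := by
    refine hP.eq_zero_of_abs_inner_le_one hq fun i ↦ ?_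
    obtain ⟨k, -, hk⟩ := hP.exists_inner_map_rhoCheck hv i
    obtain ⟨m, hm⟩ := hP.exists_int_inner_root hq i
    have h1 := hq' i hk
    rw [hm] at h1 ⊢
    norm_cast at h1 ⊢
    have h2 := abs_lt.mp (abs_height_lt_coxeterNumber B i)
    have h3 := abs_lt.mp (abs_height_lt_coxeterNumber B k)
    rw [abs_le]
    constructor <;> nlinarith
  have hv1 : v = 1 := by
    refine eq_one_of_isPos hv fun j hj k hk ↦ ?_
    obtain ⟨k', hk', hk2⟩ := hP.exists_inner_map_rhoCheck hv k
    have h1 := hq' k hk2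
    have h2 : k' = j := P.root.injective (v.injective (hk'.trans hk.symm))
    rw [hq0, inner_zero_left, mul_zero, h2, B.height_one_of_mem_support hj] at h1
    rw [RootPairing.Base.isPos_iff]
    have h3 : (B.height k : ℝ) = 1 := by push_cast at h1; linarith
    have h4 : B.height k = 1 := by exact_mod_cast h3
    lia
  ext x
  rw [h, hv1, hq0, add_zero]
  rfl

variable [P.IsIrreducible]

/-- An affine Weyl group element which nearly minimizes the distance to an interior point of the
fundamental alcove maps into the alcove. -/
theorem IsEuclidean.exists_map_eq_smul_rhoCheck (hP : IsEuclidean P) (B : P.Base)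
    (hnorm : ⟪P.root (highestRoot B), P.root (highestRoot B)⟫ = 2)
    {b : ℕ} (hb : Nat.Coprime b (coxeterNumber B)) :
    ∃ w ∈ affineWeylGroup B, w ((1 / (coxeterNumber B : ℝ)) • rhoCheck B) =
      ((b : ℝ) / coxeterNumber B) • rhoCheck B := by
  set h : ℝ := (coxeterNumber B : ℝ) with hh
  have hpos : 0 < h := by rw [hh]; exact_mod_cast coxeterNumber_pos B
  have hht : h = B.height (highestRoot B) + 1 := by rw [hh]; exact_mod_cast coxeterNumber_eq B
  set a := (1 / h) • rhoCheck B
  set x := ((b : ℝ) / h) • rhoCheck B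
  have ha (i : ι) : ⟪a, P.root i⟫ = B.height i / h := by
    rw [real_inner_smul_left, real_inner_comm, hP.inner_root_rhoCheck]
    ring
  have hbdd : BddBelow (Set.range fun g : affineWeylGroup B ↦
      ⟪(g : V ≃ᵃ[ℝ] V) x - a, (g : V ≃ᵃ[ℝ] V) x - a⟫) :=
    ⟨0, by rintro _ ⟨g, rfl⟩; exact real_inner_self_nonneg⟩
  -- The infimum need not be known to be attained: every reflection in a violated wall lowers the
  -- squared distance by at least 2/h², so coming within 2/h² of it is enough.
  obtain ⟨⟨g, hg⟩, hmin⟩ := exists_lt_of_ciInf_lt (lt_add_of_pos_right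
    (⨅ g : affineWeylGroup B, ⟪(g : V ≃ᵃ[ℝ] V) x - a, (g : V ≃ᵃ[ℝ] V) x - a⟫)
    (show 0 < 2 / h ^ 2 by positivity))
  simp only at hmin
  set y := g x
  have hlow {s : V ≃ᵃ[ℝ] V} (hs : s ∈ affineWeylGroup B) :
      ⟪y - a, y - a⟫ - 2 / h ^ 2 < ⟪s y - a, s y - a⟫ := by
    have h1 := ciInf_le hbdd ⟨s * g, mul_mem hs hg⟩
    have h2 : (s * g) x = s y := rfl
    simp only [h2] at h1
    linarith
  obtain ⟨v, hv, q, hq, hgx⟩ := hP.exists_linear_part hg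
  -- Coprimality of b and h keeps the orbit off all reflecting hyperplanes ⟪·, α⟫ ∈ ℤ; as the values
  -- lie in (1/h)ℤ, a violated wall is violated by at least 1/h.
  have hint (i : ι) : ∃ m : ℤ, h * ⟪y, P.root i⟫ = m ∧ ¬ (coxeterNumber B : ℤ) ∣ m := by
    obtain ⟨k, -, hk⟩ := hP.exists_inner_map_rhoCheck hv i
    obtain ⟨m, hm⟩ := hP.exists_int_inner_root hq i
    refine ⟨b * B.height k + coxeterNumber B * m, ?_, fun hdvd ↦ ?_⟩
    · rw [show y = v x + q from hgx x, inner_add_left, hm, map_smul, real_inner_smul_left, hk]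
      push_cast
      field_simp
      rw [hh]
      ring
    · rw [Int.dvd_add_left (dvd_mul_right _ _)] at hdvd
      have h1 := IsCoprime.dvd_of_dvd_mul_left
        (Nat.isCoprime_iff_coprime.mpr hb.symm) hdvd
      exact B.height_ne_zero k (Int.eq_zero_of_abs_lt_dvd h1 (abs_height_lt_coxeterNumber B k))
  have hsimple : ∀ j ∈ B.support, 1 / h ≤ ⟪y, P.root j⟫ := by
    intro j hj
    obtain ⟨m, hm, hndvd⟩ := hint j
    by_contra! hlt
    have hm1 : (m : ℝ) < 1 := by
      rw [← hm]
      rwa [lt_div_iff₀ hpos, mul_comm] at hlt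
    have hm2 : m ≤ -1 := by
      have h1 : m < 1 := by exact_mod_cast hm1
      have h2 : m ≠ 0 := fun h0 ↦ hndvd (h0 ▸ dvd_zero _)
      lia
    have hm3 : h * ⟪y, P.root j⟫ ≤ -1 := by rw [hm]; exact_mod_cast hm2
    have h1 := hlow (affineReflection_mem_affineWeylGroup hj)
    rw [affineReflection_apply hP, sub_zero, hP.coroot_eq, smul_smul] at h1
    have hlen : ⟪P.root j, P.root j⟫ ≤ 2 := hnorm ▸ hP.inner_root_self_le B j
    have hlen0 := inner_root_self_pos P j
    have haj := ha j
    rw [B.height_one_of_mem_support hj, Int.cast_one] at haj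
    have h2 : ⟪y - (⟪P.root j, y⟫ * (2 / ⟪P.root j, P.root j⟫)) • P.root j - a,
        y - (⟪P.root j, y⟫ * (2 / ⟪P.root j, P.root j⟫)) • P.root j - a⟫ =
        ⟪y - a, y - a⟫ + 4 / ⟪P.root j, P.root j⟫ * (⟪y, P.root j⟫ * (1 / h)) := by
      rw [← haj]
      simp only [inner_sub_left, inner_sub_right, real_inner_smul_left, real_inner_smul_right,
        real_inner_comm y (P.root j), real_inner_comm a (P.root j)]
      field_simp
      ring
    rw [h2] at h1
    have h3 : ⟪y, P.root j⟫ * (1 / h) ≤ -(1 / h ^ 2) := by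
      have : ⟪y, P.root j⟫ * (1 / h) = h * ⟪y, P.root j⟫ * (1 / h ^ 2) := by field_simp
      rw [this]
      have : 0 < 1 / h ^ 2 := by positivity
      nlinarith
    have h4 : 2 ≤ 4 / ⟪P.root j, P.root j⟫ := by
      rw [le_div_iff₀ hlen0]
      linarith
    have h5 : 0 < 1 / h ^ 2 := by positivity
    have h6 : 2 / h ^ 2 = 2 * (1 / h ^ 2) := by ring
    nlinarith
  have hhigh : ⟪y, P.root (highestRoot B)⟫ ≤ 1 - 1 / h := by
    obtain ⟨m, hm, hndvd⟩ := hint (highestRoot B)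
    set θ := highestRoot B
    by_contra! hlt
    have hm1 : ((coxeterNumber B : ℤ) : ℝ) - 1 < m := by
      rw [← hm, Int.cast_natCast, ← hh]
      have : h * (1 - 1 / h) = h - 1 := by field_simp
      nlinarith
    have hm2 : (coxeterNumber B : ℤ) + 1 ≤ m := by
      have h1 : (coxeterNumber B : ℤ) - 1 < m := by exact_mod_cast hm1
      have h2 : m ≠ coxeterNumber B := fun h0 ↦ hndvd (h0 ▸ dvd_rfl)
      lia
    have hm3 : h + 1 ≤ h * ⟪y, P.root θ⟫ := by
      rw [hm, hh]
      exact_mod_cast hm2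
    have h1 := hlow (affineReflection_highestRoot_mem_affineWeylGroup B)
    rw [affineReflection_apply hP, hP.coroot_eq, hnorm, div_self two_ne_zero, one_smul] at h1
    have haθ : ⟪a, P.root θ⟫ = 1 - 1 / h := by
      rw [ha, hht]
      have : (B.height θ : ℝ) + 1 ≠ 0 := hht ▸ hpos.ne'
      field_simp
      ring
    have h2 : ⟪y - (⟪P.root θ, y⟫ - 1) • P.root θ - a, y - (⟪P.root θ, y⟫ - 1) • P.root θ - a⟫ =
        ⟪y - a, y - a⟫ - 2 * (⟪y, P.root θ⟫ - 1) * (1 / h) := by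
      simp only [inner_sub_left, inner_sub_right, real_inner_smul_left, real_inner_smul_right,
        real_inner_comm y (P.root θ), real_inner_comm a (P.root θ), haθ, hnorm]
      ring
    rw [h2] at h1
    have h3 : 1 / h ≤ ⟪y, P.root θ⟫ - 1 := by
      rw [div_le_iff₀ hpos]
      linarith
    have h4 : 0 < 1 / h := by positivity
    have h5 : 2 / h ^ 2 = 2 * (1 / h) * (1 / h) := by field_simp
    nlinarith
  -- The difference y − a is dominant and pairs nonpositively with θ, since ⟪a, θ⟫ = 1 − 1/h; as θ
  -- dominates every simple root, all pairings vanish.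
  have hya : y = a := by
    refine eq_of_inner_simpleRoot_eq B fun j hj ↦ ?_
    have haj := ha j
    rw [B.height_one_of_mem_support hj, Int.cast_one] at haj
    have h1 : ∀ j ∈ B.support, 0 ≤ ⟪y - a, P.root j⟫ := by
      intro j hj
      rw [inner_sub_left, ha, B.height_one_of_mem_support hj, Int.cast_one]
      linarith [hsimple j hj]
    have h2 := hP.inner_le_inner_highestRoot B h1 j
    have h3 : ⟪a, P.root (highestRoot B)⟫ = 1 - 1 / h := by
      rw [ha, hht]
      have : (B.height (highestRoot B) : ℝ) + 1 ≠ 0 := hht ▸ hpos.ne'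
      field_simp
      ring
    have h4 := hsimple j hj
    rw [inner_sub_left, inner_sub_left, haj, h3] at h2
    rw [real_inner_comm, real_inner_comm a, haj]
    linarith
  exact ⟨g⁻¹, inv_mem hg, by rw [← hya]; exact g.symm_apply_apply x⟩

end AffineWeylGroup

/-! ### The quadratic inequality on the dilated alcove -/

section DilatedAlcove

variable {ι V : Type*} [NormedAddCommGroup V] [InnerProductSpace ℝ V]
  {P : RootPairing ι ℝ V V}

theorem sum_eq_two_smul_sum_isPos [Fintype ι] (B : P.Base) [DecidablePred B.IsPos] (F : ι → V)
    (hF : ∀ i, F (P.reflectionPerm i i) = F i) :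
    ∑ i, F i = (2 : ℝ) • ∑ i with B.IsPos i, F i := by
  have h : ∑ i with ¬ B.IsPos i, F i = ∑ i with B.IsPos i, F i := by
    refine Finset.sum_nbij' (fun i ↦ P.reflectionPerm i i) (fun i ↦ P.reflectionPerm i i)
      (fun i hi ↦ ?_) (fun i hi ↦ ?_) (fun i _ ↦ reflectionPerm_neg_neg P i)
      (fun i _ ↦ reflectionPerm_neg_neg P i) fun i _ ↦ (hF i).symm
    · simp only [Finset.mem_filter, Finset.mem_univ, true_and] at hi ⊢
      exact (isPos_or_isPos_neg B i).resolve_left hi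
    · simp only [Finset.mem_filter, Finset.mem_univ, true_and] at hi ⊢
      rw [RootPairing.Base.isPos_iff] at hi ⊢
      rw [height_neg]
      lia
  rw [← Finset.sum_filter_add_sum_filter_not _ B.IsPos, h, two_smul]

theorem rootSign_eq_one_or (B : P.Base) (i : ι) : rootSign B i = 1 ∨ rootSign B i = -1 := by
  rcases isPos_or_isPos_neg B i with h | h
  · exact Or.inl (rootSign_of_isPos h)
  · have := rootSign_of_isPos h
    rw [rootSign_neg] at this
    exact Or.inr (by linarith)

variable [Fintype ι] [Nonempty ι] [P.IsCrystallographic] [P.IsReduced] [P.IsIrreducible]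

theorem IsEuclidean.rootSign_mul_inner_mem_Icc (hP : IsEuclidean P) {B : P.Base} {y : V} {b : ℝ}
    (hy : ∀ j ∈ B.support, 0 ≤ ⟪y, P.root j⟫) (hyb : ⟪y, P.root (highestRoot B)⟫ ≤ b) (i : ι) :
    rootSign B i * ⟪y, P.root i⟫ ∈ Set.Icc 0 b := by
  have key {i : ι} (hi : B.IsPos i) : ⟪y, P.root i⟫ ∈ Set.Icc 0 b :=
    ⟨inner_nonneg_of_isPos hy hi, (hP.inner_le_inner_highestRoot B hy i).trans hyb⟩
  rcases isPos_or_isPos_neg B i with hi | hi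
  · rw [rootSign_of_isPos hi, one_mul]
    exact key hi
  · have h1 := rootSign_of_isPos hi
    have h2 := key hi
    rw [rootSign_neg] at h1
    rw [root_neg, inner_neg_right] at h2
    rw [show rootSign B i = -1 by linarith, neg_one_mul]
    exact h2

/-- The terms linear in y come from the sum of signed coroots, the quadratic ones from the operator
with scalar 2h, where signs square to 1. For y in the dilated alcove each summand is a product of
nonnegative factors. -/
theorem IsEuclidean.two_mul_sub_eq_sum (hP : IsEuclidean P) (B : P.Base) (y : V) (b : ℝ) :
    2 * (2 * b * ⟪rhoCheck B, y⟫ - coxeterNumber B * ⟪y, y⟫) =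
      ∑ i, 2 / ⟪P.root i, P.root i⟫ * (rootSign B i * ⟪y, P.root i⟫ *
        (b - rootSign B i * ⟪y, P.root i⟫)) := by
  have h1 := congrArg (fun z ↦ ⟪z, y⟫) (hP.sum_rootSign_smul_coroot B)
  have h2 := congrArg (fun z ↦ ⟪z, y⟫) (hP.sum_inner_smul_coroot B y)
  simp only [sum_inner, real_inner_smul_left] at h1 h2
  calc _ = b * (4 * ⟪rhoCheck B, y⟫) - 2 * coxeterNumber B * ⟪y, y⟫ := by ring
    _ = _ := by
      rw [← h1, ← h2, Finset.mul_sum, ← Finset.sum_sub_distrib]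
      refine Finset.sum_congr rfl fun i _ ↦ ?_
      rw [real_inner_comm y, hP.inner_coroot]
      rcases rootSign_eq_one_or B i with h | h <;> rw [h] <;> ring

theorem IsEuclidean.coxeterNumber_mul_inner_self_le (hP : IsEuclidean P) {B : P.Base} {y : V}
    {b : ℝ} (hy : ∀ j ∈ B.support, 0 ≤ ⟪y, P.root j⟫)
    (hyb : ⟪y, P.root (highestRoot B)⟫ ≤ b) :
    coxeterNumber B * ⟪y, y⟫ ≤ 2 * b * ⟪rhoCheck B, y⟫ := by
  have h := hP.two_mul_sub_eq_sum B y b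
  have h2 : 0 ≤ ∑ i, 2 / ⟪P.root i, P.root i⟫ * (rootSign B i * ⟪y, P.root i⟫ *
      (b - rootSign B i * ⟪y, P.root i⟫)) := Finset.sum_nonneg fun i _ ↦ by
    obtain ⟨h3, h4⟩ := hP.rootSign_mul_inner_mem_Icc hy hyb i
    have := inner_root_self_pos P i
    exact mul_nonneg (by positivity) (mul_nonneg h3 (sub_nonneg.mpr h4))
  linarith

/-- Equality makes every summand vanish, so z = y/b pairs with each root to 0 or ±1. It remains to
show that z lies in the coroot lattice. -/
theorem IsEuclidean.eq_zero_of_coxeterNumber_mul_inner_self_eq (hP : IsEuclidean P) {B : P.Base}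
    {y : V} {b : ℕ} (hb : Nat.Coprime b (coxeterNumber B)) (hb0 : 0 < b)
    (hy : ∀ j ∈ B.support, 0 ≤ ⟪y, P.root j⟫)
    (hyb : ⟪y, P.root (highestRoot B)⟫ ≤ b) (hyQ : y ∈ P.corootSpan ℤ)
    (heq : coxeterNumber B * ⟪y, y⟫ = 2 * b * ⟪rhoCheck B, y⟫) : y = 0 := by
  classical
  have hbpos : (0 : ℝ) < b := by exact_mod_cast hb0
  have hterm (i : ι) : rootSign B i * ⟪y, P.root i⟫ = 0 ∨ rootSign B i * ⟪y, P.root i⟫ = b := by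
    have h := hP.two_mul_sub_eq_sum B y b
    rw [heq, sub_self, mul_zero, eq_comm, Finset.sum_eq_zero_iff_of_nonneg] at h
    · have h1 := h i (Finset.mem_univ i)
      have h2 : 2 / ⟪P.root i, P.root i⟫ ≠ 0 :=
        div_ne_zero two_ne_zero (inner_root_self_pos P i).ne'
      rcases mul_eq_zero.mp ((mul_eq_zero_iff_left h2).mp h1) with h3 | h3
      · exact Or.inl h3
      · exact Or.inr (by linarith)
    · intro i _
      obtain ⟨h3, h4⟩ := hP.rootSign_mul_inner_mem_Icc hy hyb i
      have := inner_root_self_pos P i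
      exact mul_nonneg (by positivity) (mul_nonneg h3 (sub_nonneg.mpr h4))
  set z : V := (1 / (b : ℝ)) • y with hz
  have hbz : (b : ℝ) • z = y := by
    rw [hz, smul_smul, mul_one_div_cancel hbpos.ne', one_smul]
  have hzint (i : ι) : ∃ m : ℤ, |m| ≤ 1 ∧ ⟪z, P.root i⟫ = m := by
    have h1 : ⟪z, P.root i⟫ = 1 / b * ⟪y, P.root i⟫ := by rw [hz, real_inner_smul_left]
    rcases rootSign_eq_one_or B i with h | h <;> rcases hterm i with h2 | h2 <;> rw [h] at h2
    · exact ⟨0, by simp, by rw [h1, show ⟪y, P.root i⟫ = 0 by linarith]; simp⟩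
    · exact ⟨1, by simp, by
        rw [h1, show ⟪y, P.root i⟫ = b by linarith, one_div_mul_cancel hbpos.ne']; simp⟩
    · exact ⟨0, by simp, by rw [h1, show ⟪y, P.root i⟫ = 0 by linarith]; simp⟩
    · exact ⟨-1, by simp, by
        rw [h1, show ⟪y, P.root i⟫ = -b by linarith, mul_neg, one_div_mul_cancel hbpos.ne']; simp⟩
  -- The sum of ⟪z, α⟫ α^∨ over all roots is 2h z. Opposite roots contribute equally, so the sum
  -- over positive roots alone exhibits h z as an integral combination of coroots; a Bézout relation
  -- with b z = y then yields z.
  have hhz : (coxeterNumber B : ℝ) • z ∈ P.corootSpan ℤ := by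
    have h1 := hP.sum_inner_smul_coroot B z
    rw [sum_eq_two_smul_sum_isPos B _ fun i ↦ by
      rw [root_neg, coroot_neg, inner_neg_right, neg_smul_neg], mul_smul] at h1
    rw [← smul_right_injective V (two_ne_zero (α := ℝ)) h1]
    refine sum_mem fun i _ ↦ ?_
    obtain ⟨m, -, hm⟩ := hzint i
    rw [hm, Int.cast_smul_eq_zsmul]
    exact Submodule.smul_mem _ m (Submodule.subset_span ⟨i, rfl⟩)
  have hzQ : z ∈ P.corootSpan ℤ := by
    obtain ⟨u, v, huv⟩ := Nat.isCoprime_iff_coprime.mpr hb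
    have huv' : (u : ℝ) * b + v * coxeterNumber B = 1 := by exact_mod_cast huv
    clear_value z
    have h1 : z = u • y + v • ((coxeterNumber B : ℝ) • z) := by
      have h2 : u • y = ((u : ℝ) * b) • z := by
        rw [mul_smul, hbz, Int.cast_smul_eq_zsmul]
      rw [h2, ← Int.cast_smul_eq_zsmul ℝ v, smul_smul, ← add_smul, huv', one_smul]
    rw [h1]
    exact add_mem (Submodule.smul_mem _ _ hyQ) (Submodule.smul_mem _ _ hhz)
  have hz0 : z = 0 := hP.eq_zero_of_abs_inner_le_one hzQ fun i ↦ by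
    obtain ⟨m, hm, hzm⟩ := hzint i
    rw [hzm]
    exact_mod_cast hm
  rw [← hbz, hz0, smul_zero]

end DilatedAlcove

/-! ### The Sommers region and the dilated alcove -/

section SommersRegion

variable {ι V : Type*} [Finite ι] [Nonempty ι] [NormedAddCommGroup V] [InnerProductSpace ℝ V]
  {P : RootPairing ι ℝ V V}

/-- The defining inequalities of the Sommers region, in uniform form. -/
theorem le_inner_of_mem_sommersRegion {B : P.Base} {b : ℕ} {x : V} (hx : x ∈ sommersRegion B b)
    {k : ι} (hk : (coxeterNumber B : ℤ) ∣ b - B.height k) :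
    ((B.height k : ℝ) - b) / coxeterNumber B ≤ ⟪x, P.root k⟫ := by
  have hpos : (0 : ℝ) < coxeterNumber B := by exact_mod_cast coxeterNumber_pos B
  have hlt := Nat.mod_lt b (coxeterNumber_pos B)
  have hdiv : (coxeterNumber B : ℤ) * (b / coxeterNumber B : ℕ) + (b % coxeterNumber B : ℕ) = b := by
    exact_mod_cast Nat.div_add_mod b (coxeterNumber B)
  have hdivR : (coxeterNumber B : ℝ) * (b / coxeterNumber B : ℕ) + (b % coxeterNumber B : ℕ) = b := by
    exact_mod_cast hdiv
  have hltZ : ((b % coxeterNumber B : ℕ) : ℤ) < coxeterNumber B := by exact_mod_cast hlt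
  have hmod : 0 ≤ ((b % coxeterNumber B : ℕ) : ℤ) := Int.natCast_nonneg _
  have habs := abs_lt.mp (abs_height_lt_coxeterNumber B k)
  -- Heights lie strictly between −h and h, so the residue class of b contains only r and r − h. The
  -- second case is the negative of a root of height h − r, whose upper bound becomes a lower bound.
  have hcases : B.height k = (b % coxeterNumber B : ℕ) ∨
      B.height k = (b % coxeterNumber B : ℕ) - (coxeterNumber B : ℤ) := by
    obtain ⟨m, hm⟩ := hk
    have h1 : ((b % coxeterNumber B : ℕ) : ℤ) - B.height k =
        coxeterNumber B * (m - (b / coxeterNumber B : ℕ)) := by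
      linear_combination hm + hdiv
    generalize m - (b / coxeterNumber B : ℕ) = m' at h1
    have h2 : -1 < m' := by
      by_contra! h
      nlinarith
    have h3 : m' < 2 := by
      by_contra! h
      nlinarith
    obtain rfl | rfl : m' = 0 ∨ m' = 1 := by lia
    · left; lia
    · right; lia
  rw [div_le_iff₀ hpos]
  rcases hcases with h | h
  · have h1 := hx.1 k h
    rw [h, Int.cast_natCast]
    nlinarith
  · have h1 := hx.2 (P.reflectionPerm k k) (by rw [height_neg, h]; ring)
    rw [root_neg, inner_neg_right] at h1
    rw [h, Int.cast_sub, Int.cast_natCast, Int.cast_natCast]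
    nlinarith

variable [P.IsCrystallographic] [P.IsReduced] [P.IsRootSystem]

/-- An affine Weyl group element which maps `ρ / h` to `b ρ / h` permutes the affine functionals
`⟪·, α⟫` up to translations determined by the heights. -/
theorem IsEuclidean.exists_inner_map_eq (hP : IsEuclidean P) {B : P.Base} {b : ℕ} {w : V ≃ᵃ[ℝ] V}
    (hw : w ∈ affineWeylGroup B) (hwρ : w ((1 / (coxeterNumber B : ℝ)) • rhoCheck B) =
      ((b : ℝ) / coxeterNumber B) • rhoCheck B) :
    ∃ σ : Equiv.Perm ι, ∀ k,
      (coxeterNumber B : ℤ) ∣ b * B.height (σ k) - B.height k ∧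
      ∀ x, ⟪w x, P.root (σ k)⟫ =
        ⟪x, P.root k⟫ + (b * B.height (σ k) - B.height k) / coxeterNumber B := by
  have hpos : (0 : ℝ) < coxeterNumber B := by exact_mod_cast coxeterNumber_pos B
  obtain ⟨v, hv, q, hq, hwx⟩ := hP.exists_linear_part hw
  obtain ⟨l, -, hl⟩ := exists_word_of_mem_simpleWeylGroup hv
  refine ⟨wordPerm P l, fun k ↦ ?_⟩
  have hinner (x : V) : ⟪w x, P.root (wordPerm P l k)⟫ =
      ⟪x, P.root k⟫ + ⟪q, P.root (wordPerm P l k)⟫ := by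
    rw [hwx, inner_add_left, ← hl, hP.inner_map_map_of_mem hv]
  have hqk := hinner ((1 / (coxeterNumber B : ℝ)) • rhoCheck B)
  rw [hwρ, real_inner_smul_left, real_inner_smul_left, real_inner_comm, hP.inner_root_rhoCheck,
    real_inner_comm, hP.inner_root_rhoCheck] at hqk
  have hqk' : ⟪q, P.root (wordPerm P l k)⟫ =
      (b * B.height (wordPerm P l k) - B.height k) / coxeterNumber B := by
    field_simp at hqk ⊢
    linarith
  refine ⟨?_, fun x ↦ by rw [hinner, hqk']⟩
  obtain ⟨m, hm⟩ := hP.exists_int_inner_root hq (wordPerm P l k)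
  rw [hm, eq_div_iff hpos.ne'] at hqk'
  exact ⟨m, by rw [mul_comm (coxeterNumber B : ℤ) m]; exact_mod_cast hqk'.symm⟩

/-- The walls of the dilated alcove belong to the simple roots and −θ, all of height congruent to 1
modulo h. Their preimages under σ have height congruent to b, exactly the roots that cut out the
Sommers region. -/
theorem IsEuclidean.map_sommersRegion (hP : IsEuclidean P) {B : P.Base} {b : ℕ} {w : V ≃ᵃ[ℝ] V}
    (hw : w ∈ affineWeylGroup B) (hwρ : w ((1 / (coxeterNumber B : ℝ)) • rhoCheck B) =
      ((b : ℝ) / coxeterNumber B) • rhoCheck B) {x : V} (hx : x ∈ sommersRegion B b) :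
    (∀ j ∈ B.support, 0 ≤ ⟪w x, P.root j⟫) ∧ ⟪w x, P.root (highestRoot B)⟫ ≤ b := by
  have hpos : (0 : ℝ) < coxeterNumber B := by exact_mod_cast coxeterNumber_pos B
  obtain ⟨σ, hσ⟩ := hP.exists_inner_map_eq hw hwρ
  constructor
  · intro j hj
    obtain ⟨k, rfl⟩ := σ.surjective j
    obtain ⟨hdvd, hk⟩ := hσ k
    rw [B.height_one_of_mem_support hj] at hdvd hk
    rw [mul_one] at hdvd
    have h := le_inner_of_mem_sommersRegion hx hdvd
    rw [hk, Int.cast_one, mul_one]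
    have h2 : ((b : ℝ) - B.height k) / coxeterNumber B =
        -(((B.height k : ℝ) - b) / coxeterNumber B) := by ring
    linarith
  · obtain ⟨k, hkθ⟩ := σ.surjective (highestRoot B)
    obtain ⟨hdvd, hk⟩ := hσ k
    have hθ : B.height (highestRoot B) = coxeterNumber B - 1 := by rw [coxeterNumber_eq]; ring
    rw [hkθ, hθ] at hdvd hk
    have hdvd' : (coxeterNumber B : ℤ) ∣ b - B.height (P.reflectionPerm k k) := by
      rw [height_neg]
      obtain ⟨m, hm⟩ := hdvd
      exact ⟨b - m, by linear_combination -hm⟩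
    have h := le_inner_of_mem_sommersRegion hx hdvd'
    rw [height_neg, root_neg, inner_neg_right] at h
    rw [hk]
    push_cast at h ⊢
    have h2 : ((b : ℝ) * (coxeterNumber B - 1) - B.height k) / coxeterNumber B =
        b + (-B.height k - b) / coxeterNumber B := by
      field_simp
      ring
    linarith

/-- Coprimality allows b to be cancelled in the congruences: roots of height r go under σ to heights
congruent to 1, hence at most 1, and roots of height h − r to heights at least −1. These bounds are
the defining inequalities at the preimage of 0. -/
theorem IsEuclidean.inv_zero_mem_sommersRegion (hP : IsEuclidean P) {B : P.Base} {b : ℕ}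
    (hb : Nat.Coprime b (coxeterNumber B)) {w : V ≃ᵃ[ℝ] V}
    (hw : w ∈ affineWeylGroup B) (hwρ : w ((1 / (coxeterNumber B : ℝ)) • rhoCheck B) =
      ((b : ℝ) / coxeterNumber B) • rhoCheck B) : w⁻¹ 0 ∈ sommersRegion B b := by
  have hpos : (0 : ℝ) < coxeterNumber B := by exact_mod_cast coxeterNumber_pos B
  have hdiv : (coxeterNumber B : ℤ) * (b / coxeterNumber B : ℕ) + (b % coxeterNumber B : ℕ) = b := by
    exact_mod_cast Nat.div_add_mod b (coxeterNumber B)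
  have hdivR : (coxeterNumber B : ℝ) * (b / coxeterNumber B : ℕ) + (b % coxeterNumber B : ℕ) = b := by
    exact_mod_cast hdiv
  have hcop : IsCoprime (coxeterNumber B : ℤ) b := Nat.isCoprime_iff_coprime.mpr hb.symm
  obtain ⟨σ, hσ⟩ := hP.exists_inner_map_eq hw hwρ
  have h0 : w (w⁻¹ 0) = 0 := w.apply_symm_apply 0
  refine ⟨fun k hk ↦ ?_, fun k hk ↦ ?_⟩
  · obtain ⟨⟨m, hm⟩, hk'⟩ := hσ k
    have h1 := hk' (w⁻¹ 0)
    rw [h0, inner_zero_left] at h1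
    have h2 : (coxeterNumber B : ℤ) ∣ b * (B.height (σ k) - 1) :=
      ⟨m - (b / coxeterNumber B : ℕ), by linear_combination hm + hk + hdiv⟩
    have h3 : B.height (σ k) ≤ 1 := by
      have h4 := (abs_lt.mp (abs_height_lt_coxeterNumber B (σ k))).2
      by_contra! h5
      have h6 := Int.le_of_dvd (by lia) (hcop.dvd_of_dvd_mul_left h2)
      lia
    have h4 : (B.height (σ k) : ℝ) ≤ 1 := by exact_mod_cast h3
    have h5 : ((b : ℝ) * B.height (σ k) - B.height k) / coxeterNumber B ≤
        (b / coxeterNumber B : ℕ) := by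
      rw [div_le_iff₀ hpos, hk, Int.cast_natCast]
      nlinarith [Nat.cast_nonneg (α := ℝ) b]
    linarith
  · obtain ⟨⟨m, hm⟩, hk'⟩ := hσ k
    have h1 := hk' (w⁻¹ 0)
    rw [h0, inner_zero_left] at h1
    have h2 : (coxeterNumber B : ℤ) ∣ b * (B.height (σ k) + 1) :=
      ⟨m + (b / coxeterNumber B : ℕ) + 1, by linear_combination hm + hk - hdiv⟩
    have h3 : -1 ≤ B.height (σ k) := by
      have h4 := (abs_lt.mp (abs_height_lt_coxeterNumber B (σ k))).1
      by_contra! h5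
      have h6 := Int.le_of_dvd (by lia) ((dvd_neg).mpr (hcop.dvd_of_dvd_mul_left h2))
      lia
    have h4 : (-1 : ℝ) ≤ B.height (σ k) := by exact_mod_cast h3
    have h5 : -((b / coxeterNumber B : ℕ) + 1 : ℝ) ≤
        ((b : ℝ) * B.height (σ k) - B.height k) / coxeterNumber B := by
      rw [le_div_iff₀ hpos, hk, Int.cast_sub, Int.cast_natCast, Int.cast_natCast]
      nlinarith [Nat.cast_nonneg (α := ℝ) b]
    linarith

end SommersRegion

/-- The size is, up to scale and a constant, the squared distance from q to ρ/h. The isometry w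
replaces this by the distance from w q to bρ/h, and the norm of ρ supplies the constant. -/
theorem IsEuclidean.size_eq_add {ι V : Type*} [Fintype ι] [Nonempty ι]
    [NormedAddCommGroup V] [InnerProductSpace ℝ V] {P : RootPairing ι ℝ V V}
    [P.IsCrystallographic] [P.IsReduced] [P.IsIrreducible] (hP : IsEuclidean P) (B : P.Base)
    (hnorm : ⟪P.root (highestRoot B), P.root (highestRoot B)⟫ = 2) {b : ℕ} {w : V ≃ᵃ[ℝ] V}
    (hw : w ∈ affineWeylGroup B) (hwρ : w ((1 / (coxeterNumber B : ℝ)) • rhoCheck B) =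
      ((b : ℝ) / coxeterNumber B) • rhoCheck B) (q : V) :
    size B q = lengthRatio P * dualCoxeterNumber B.flip / coxeterNumber B *
        (Module.finrank ℝ V * ((b : ℝ) ^ 2 - 1) * (coxeterNumber B + 1) / 24) +
      (coxeterNumber B * ⟪w q, w q⟫ - 2 * b * ⟪rhoCheck B, w q⟫) / 2 := by
  have hpos : (0 : ℝ) < coxeterNumber B := by exact_mod_cast coxeterNumber_pos B
  have h1 := hP.inner_sub_map_affine hw q ((1 / (coxeterNumber B : ℝ)) • rhoCheck B)
  have h2 := hP.inner_rhoCheck_self B hnorm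
  rw [hwρ] at h1
  simp only [inner_sub_left, inner_sub_right, real_inner_smul_left, real_inner_smul_right,
    real_inner_comm (rhoCheck B) q, real_inner_comm (rhoCheck B) (w q)] at h1
  have h3 : lengthRatio P * dualCoxeterNumber B.flip / coxeterNumber B *
      (Module.finrank ℝ V * ((b : ℝ) ^ 2 - 1) * (coxeterNumber B + 1) / 24) =
      ⟪rhoCheck B, rhoCheck B⟫ * ((b : ℝ) ^ 2 - 1) / (2 * coxeterNumber B) := by
    rw [h2]
    field_simp
    ring
  rw [h3, size_eq, inner_sub_left, real_inner_smul_left]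
  field_simp at h1 ⊢
  linear_combination -h1

end SimultaneousCores

/-! ### The maximum size and its unique maximizer -/

theorem theorem6p3 {ι V : Type*} [Finite ι] [Nonempty ι]
    [NormedAddCommGroup V] [InnerProductSpace ℝ V]
    (P : RootPairing ι ℝ V V) [P.IsRootSystem] [P.IsCrystallographic] [P.IsReduced]
    [P.IsIrreducible] (hP : SimultaneousCores.IsEuclidean P) (B : P.Base)
    (hnorm : ⟪P.root (SimultaneousCores.highestRoot B),
      P.root (SimultaneousCores.highestRoot B)⟫ = 2)
    (b : ℕ) (hb : Nat.Coprime b (SimultaneousCores.coxeterNumber B)) :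
    let h : ℝ := SimultaneousCores.coxeterNumber B
    let n : ℝ := Module.finrank ℝ V
    let r : ℝ := SimultaneousCores.lengthRatio P
    let g : ℝ := SimultaneousCores.dualCoxeterNumber B.flip
    let maxSize : ℝ := r * g / h * (n * ((b : ℝ) ^ 2 - 1) * (h + 1) / 24)
    let cores : Set V := SimultaneousCores.sommersRegion B b ∩ SimultaneousCores.corootLattice P
    let ρ : V := SimultaneousCores.rhoCheck B
    IsGreatest (SimultaneousCores.size B '' cores) maxSize ∧
    ∃ w : V ≃ᵃ[ℝ] V,
      (w ∈ SimultaneousCores.affineWeylGroup B ∧ w ((1 / h) • ρ) = ((b : ℝ) / h) • ρ) ∧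
      (∀ w' ∈ SimultaneousCores.affineWeylGroup B,
        w' ((1 / h) • ρ) = ((b : ℝ) / h) • ρ → w' = w) ∧
      w⁻¹ 0 ∈ cores ∧
      ∀ q ∈ cores, SimultaneousCores.size B q = maxSize ↔ q = w⁻¹ 0 := by
  intro h n r g maxSize cores ρ
  have := Fintype.ofFinite ι
  obtain ⟨w, hw, hwρ⟩ := hP.exists_map_eq_smul_rhoCheck B hnorm hb
  have hsize (q : V) : SimultaneousCores.size B q =
      maxSize + (h * ⟪w q, w q⟫ - 2 * b * ⟪ρ, w q⟫) / 2 := hP.size_eq_add B hnorm hw hwρ q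
  -- For b = 0 coprimality would force h = 1, but h ≥ 2 because the highest root has positive
  -- height.
  have hb0 : 0 < b := by
    by_contra! hb0
    have h1 := B.isPos_iff.mp (SimultaneousCores.isPos_highestRoot B)
    have h2 := SimultaneousCores.coxeterNumber_eq B
    rw [nonpos_iff_eq_zero.mp hb0, Nat.coprime_zero_left] at hb
    lia
  have h0 : w (w⁻¹ 0) = 0 := w.apply_symm_apply 0
  have hmem : w⁻¹ 0 ∈ cores := by
    refine ⟨hP.inv_zero_mem_sommersRegion hb hw hwρ, ?_⟩
    obtain ⟨v, -, q, hq, hwq⟩ := hP.exists_linear_part (inv_mem hw)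
    rw [hwq, map_zero, zero_add]
    exact hq
  have hmax : SimultaneousCores.size B (w⁻¹ 0) = maxSize := by
    rw [hsize, h0]
    simp
  have hle : ∀ q ∈ cores, h * ⟪w q, w q⟫ ≤ 2 * b * ⟪ρ, w q⟫ := fun q hq ↦ by
    obtain ⟨h1, h2⟩ := hP.map_sommersRegion hw hwρ hq.1
    exact hP.coxeterNumber_mul_inner_self_le h1 h2
  refine ⟨⟨⟨_, hmem, hmax⟩, ?_⟩, w, ⟨hw, hwρ⟩, ?_, hmem, fun q hq ↦ ⟨fun hqm ↦ ?_, ?_⟩⟩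
  · rintro _ ⟨q, hq, rfl⟩
    have h1 := hle q hq
    rw [hsize]
    linarith
  · intro w' hw' hw'ρ
    have h1 : w⁻¹ * w' = 1 := hP.eq_one_of_fixes (mul_mem (inv_mem hw) hw') (by
      change w⁻¹ (w' _) = _
      rw [hw'ρ, ← hwρ]
      exact w.symm_apply_apply _)
    rw [← mul_one w, ← h1, mul_inv_cancel_left]
  · obtain ⟨h1, h2⟩ := hP.map_sommersRegion hw hwρ hq.1
    have hwQ : w q ∈ P.corootSpan ℤ := by
      obtain ⟨v, hv, p, hp, hwq⟩ := hP.exists_linear_part hw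
      rw [hwq]
      exact add_mem (hP.map_mem_corootSpan hv hq.2) hp
    rw [hsize] at hqm
    have h3 := hP.eq_zero_of_coxeterNumber_mul_inner_self_eq hb hb0 h1 h2 hwQ
      (by change h * ⟪w q, w q⟫ = 2 * b * ⟪ρ, w q⟫; linarith)
    rw [← h3]
    exact (w.symm_apply_apply q).symm
  · rintro rfl
    exact hmax
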